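/- Let $\Gamma\subset \mathrm{SL}_2(\mathbb Z)$ be a congruence subgroup, let $N\ge 1$ be an integer with $\Gamma(N)\subset\Gamma$, and let $f$ be a modular form of integer weight $k\ge 2$ for $\Gamma$ (holomorphic on the upper half plane and at all cusps), with Fourier expansion $f(\tau)=\sum_{n\ge 0}a_n q^{n/N}$, $q=e(\tau)$, where $e(z)=e^{2\pi i z}$. Write $(f|_k\delta)(\tau)=(C\tau+D)^{-k}f(\delta\tau)$ for $\delta=\begin{pmatrix}A&B\\C&D\end{pmatrix}\in \mathrm{SL}_2(\mathbb Z)$. (i) For every $y\in\mathbb Q$ the series $L_f(s;y)=N^s\sum_{n\ge1}a_n e(ny/N)n^{-s}$ converges absolutely for $\mathrm{Re}(s)>k$, and $$\widehat L_f(s;y)=-(2\pi)^{-s}e(-s/4)\,\Gamma(s)\,L_f(s;y)$$ extends meromorphically to $\mathbb C$, holomorphically on $\mathbb C\setminus\{0,k\}$. Put $S_f(y)=\widehat L_f(k-1;y)$. (ii) For every rational $x=r/p$ in lowest terms with $p>0$ there is exactly one $a_0^{(x)}\in\mathbb C$ such that $(f|_k\delta)(\tau)=a_0^{(x)}+O(q^{1/N_x})$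 as $\mathrm{Im}\,\tau\to\infty$ for some $\delta\in \mathrm{SL}_2(\mathbb Z)$ with first column $(r,p)^T$ and some positive integer $N_x$. (iii) For $\gamma=\begin{pmatrix}a&b\\c&d\end{pmatrix}\in\Gamma$ with $c\ne0$ let $$R_{f,\gamma}(X)=-\sum_{j=0}^{k-2}\binom{k-2}{j}\widehat L_f\Bigl(j+1;-\frac dc\Bigr)\Bigl(\frac{cX+d}{c}\Bigr)^{k-2-j}-\frac{a_0}{k-1}\left(\Bigl(\frac{cX+d}{c}\Bigr)^{k-1}-\frac{1}{(-c)^{k-1}(cX+d)}\right),$$ and let $R_{f,\gamma}=0$ if $c=0$. Then $R_{f,\gamma}(X)\in\frac1{cX+d}\mathbb C[X]$, and for every rational $x=r/p$ (lowest terms, $p>0$) with $cx+d\neq0$, $$(cx+d)^{k-2}S_f\Bigl(\frac{ax+b}{cx+d}\Bigr)-S_f(x)=R_{f,\gamma}(x)-\frac{a_0^{(x)}}{p^k}\,\frac{c}{cx+d}.$$ -/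

import Mathlib

open UpperHalfPlane
open scoped MatrixGroups ModularForm

noncomputable section

namespace DedekindReciprocity

/-- `e(z) = exp(2πiz)`. -/
def e (z : ℂ) : ℂ := Complex.exp (2 * Real.pi * Complex.I * z)

/-- The Fourier coefficients `a_n` of `f`, in `f(τ) = ∑ a_n q^(n/N)`, `q = e(τ)`. -/
def fourierCoeff (N : ℕ) (f : ℍ → ℂ) (n : ℕ) : ℂ := (qExpansion (N : ℝ) f).coeff n

/-- The additively twisted coefficients `a_n e(n y / N)`. -/
def twistedCoeff (N : ℕ) (f : ℍ → ℂ) (y : ℚ) (n : ℕ) : ℂ :=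
  fourierCoeff N f n * e (n * y / N)

/-- The twisted L-series `L_f(s; y) = N^s ∑_{n ≥ 1} a_n e(n y / N) n^(-s)`; Mathlib's `LSeries`
sums over `n ≥ 1` only. Meaningful where the series converges, in particular for `Re s > k`. -/
def twistedLSeries (N : ℕ) (f : ℍ → ℂ) (y : ℚ) (s : ℂ) : ℂ :=
  (N : ℂ) ^ s * LSeries (twistedCoeff N f y) s

/-- `Λ` is the meromorphic continuation to `ℂ`, holomorphic outside `{0, k}`, of
`-(2π)^(-s) e(-s/4) Γ(s) L_f(s; y)`, which is given by a convergent series for `Re s > k`. -/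
structure IsCompletedTwistedL (N k : ℕ) (f : ℍ → ℂ) (y : ℚ) (Λ : ℂ → ℂ) : Prop where
  meromorphic : Meromorphic Λ
  differentiableOn : DifferentiableOn ℂ Λ {0, (k : ℂ)}ᶜ
  summable : ∀ s : ℂ, (k : ℝ) < s.re → LSeriesSummable (twistedCoeff N f y) s
  eq_series : ∀ s : ℂ, (k : ℝ) < s.re →
    Λ s = -(2 * Real.pi : ℂ) ^ (-s) * e (-s / 4) * Complex.Gamma s * twistedLSeries N f y s

/-- The completed twisted L-function `L̂_f(s; y)`, obtained by continuation. Its values at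
`s ≠ 0, k` do not depend on the choice, by the identity theorem. -/
def completedTwistedL (N k : ℕ) (f : ℍ → ℂ) (y : ℚ) : ℂ → ℂ :=
  Classical.epsilon (IsCompletedTwistedL N k f y)

/-- The generalized Dedekind sum `S_f(y) = L̂_f(k - 1; y)`. -/
def dedekindSum (N k : ℕ) (f : ℍ → ℂ) (y : ℚ) : ℂ :=
  completedTwistedL N k f y ((k : ℂ) - 1)

/-- `a` is the constant term of `f` at the cusp `x = r/p` (lowest terms, `p > 0`):
`(f|_k δ)(τ) = a + O(q^(1/M))` as `Im τ → ∞`, for some `δ ∈ SL₂(ℤ)` with first column `(r, p)`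
and some positive integer `M`. -/
def IsCuspConstant (k : ℕ) (f : ℍ → ℂ) (x : ℚ) (a : ℂ) : Prop :=
  ∃ (δ : SL(2, ℤ)) (M : ℕ), δ 0 0 = x.num ∧ δ 1 0 = (x.den : ℤ) ∧ 0 < M ∧
    (fun τ : ℍ ↦ (f ∣[(k : ℤ)] δ) τ - a) =O[atImInfty] (fun τ : ℍ ↦ e ((τ : ℂ) / M))

/-- The Fourier constant `a_0^{(x)}` of `f` at the cusp `x`. -/
def cuspConstant (k : ℕ) (f : ℍ → ℂ) (x : ℚ) : ℂ :=
  Classical.epsilon (IsCuspConstant k f x)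

/-- The regularized period polynomial `R_{f,γ}`, as a function of `X`; it is `0` when `c = 0`. -/
def regularizedPeriod (N k : ℕ) (f : ℍ → ℂ) (γ : SL(2, ℤ)) (X : ℂ) : ℂ :=
  let c : ℤ := γ 1 0
  let d : ℤ := γ 1 1
  if c = 0 then 0 else
    -∑ j ∈ Finset.range (k - 1), ((k - 2).choose j : ℂ) *
        completedTwistedL N k f (-(d : ℚ) / c) ((j : ℂ) + 1) * ((c * X + d) / c) ^ (k - 2 - j)
      - fourierCoeff N f 0 / ((k : ℂ) - 1) *
        (((c * X + d) / c) ^ (k - 1) - 1 / ((-(c : ℂ)) ^ (k - 1) * (c * X + d)))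

end DedekindReciprocity

end

/-! ### Modular forms as functions of level `N`. -/

namespace DedekindReciprocity

open Filter Topology Asymptotics
open scoped Manifold

/-! Formally, `L̂_f(j + 1; y)` is the integral of `f(z) (y - z)^j dz` from the cusp `y` to `i∞`.
With `n = k - 2`, the substitution `z = γ⁻¹u` turns `f(z) (x - z)^n dz` into `(cx + d)^n f(u) (γx -
u)^n du`. Hence `(cx + d)^n S_f(γx)` is the integral of `f(z) (x - z)^n dz` from `x` to `γ⁻¹∞ =
-d/c`. Subtracting `S_f(x)` leaves the integral from `i∞` to `-d/c`, and expanding `(x - z)^n` about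
`-d/c` gives the sum in `R_{f,γ}`.

These integrals diverge when `f` has nonzero constant terms, so the proof works with primitives. In
`exists_tendsto_completedTwistedL` a critical value is `A - B`, where `A` and `B` are the limits of
a primitive at `i∞` and at the cusp after removal of the divergent term. The divergent terms are not
invariant under `γ`, and their discrepancies are the remaining terms of the formula:
`cusp_value_transport` yields the `a_0^{(x)}` term, `value_atInfty_eq_sum` and
`value_transport_eq_sum` the two `a_0` terms of `R_{f,γ}`. Contour shifts at `i∞` are replaced by
`tendsto_vertical_sub`, and `exists_sub_dedekindSum_eq` assembles the comparison.

The continuation of `L̂_f` is a Mellin transform along the vertical line over `y`, with the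
functional equation supplied by `f ∣ δ`, `δ∞ = y`. Absolute convergence up to `Re s > k`, Eisenstein
series included, requires `a_n = O(n^(k-1+ε))`, proved in `norm_fourierCoeff_le`. -/

theorem tendsto_exp_neg_two_pi_mul_im_div {M : ℕ} (hM : 0 < M) :
    Tendsto (fun τ : ℍ ↦ Real.exp (-2 * Real.pi * τ.im / M)) atImInfty (𝓝 0) := by
  have : Tendsto (fun t : ℝ ↦ Real.exp (-2 * Real.pi * t / M)) atTop (𝓝 0) := by
    refine Real.tendsto_exp_atBot.comp ?_
    have : ∀ t : ℝ, -2 * Real.pi * t / M = (-2 * Real.pi / M) * t := fun t ↦ by ring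
    simp_rw [this]
    refine tendsto_id.const_mul_atTop_of_neg ?_
    have := Real.pi_pos
    have hM' : (0 : ℝ) < M := by exact_mod_cast hM
    rw [div_neg_iff]
    exact Or.inr ⟨by linarith, hM'⟩
  exact this.comp tendsto_comap

/-- A function on `ℍ` that is a modular form of weight `k` for the principal congruence subgroup
of level `N`. -/
structure IsFormOfLevel (N k : ℕ) (f : ℍ → ℂ) : Prop where
  mdifferentiable : MDiff f
  isBoundedAtImInfty_slash : ∀ δ : SL(2, ℤ), IsBoundedAtImInfty (f ∣[(k : ℤ)] δ)
  slash_eq : ∀ γ ∈ CongruenceSubgroup.Gamma N, f ∣[(k : ℤ)] γ = f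

theorem isFormOfLevel_of_modularForm {Γ : Subgroup SL(2, ℤ)} {N : ℕ} (hN : 0 < N)
    (hΓ : CongruenceSubgroup.Gamma N ≤ Γ) {k : ℕ}
    (f : ModularForm (Γ.map (Matrix.SpecialLinearGroup.mapGL ℝ)) (k : ℤ)) :
    IsFormOfLevel N k f where
  mdifferentiable := f.holo'
  isBoundedAtImInfty_slash δ := by
    have : NeZero N := ⟨hN.ne'⟩
    have : Γ.FiniteIndex := Subgroup.finiteIndex_of_le hΓ
    exact ModularFormClass.bdd_at_infty_slash f δ
  slash_eq γ hγ := f.slash_action_eq' _ (Subgroup.mem_map_of_mem _ (hΓ hγ))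

theorem slash_apply (k : ℕ) (f : ℍ → ℂ) (δ : SL(2, ℤ)) (τ : ℍ) :
    (f ∣[(k : ℤ)] δ) τ = f (δ • τ) * (((δ 1 0 : ℂ) * τ + δ 1 1) ^ k)⁻¹ := by
  rw [ModularForm.SL_slash_apply, ModularGroup.denom_apply, zpow_neg, zpow_natCast]

namespace IsFormOfLevel

variable {N k : ℕ} {f : ℍ → ℂ}

/-- Normality of `Γ(N)` makes the class stable under all of `SL(2, ℤ)`, so any cusp can be moved to
`i∞`. -/
theorem slash (hf : IsFormOfLevel N k f) (δ : SL(2, ℤ)) : IsFormOfLevel N k (f ∣[(k : ℤ)] δ) where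
  mdifferentiable := hf.mdifferentiable.slash k (δ : GL (Fin 2) ℝ)
  isBoundedAtImInfty_slash ε := by
    rw [← SlashAction.slash_mul]
    exact hf.isBoundedAtImInfty_slash _
  slash_eq γ hγ := by
    have h := hf.slash_eq _ ((CongruenceSubgroup.Gamma_normal N).conj_mem γ hγ δ)
    rw [← SlashAction.slash_mul]
    nth_rewrite 2 [← h]
    rw [← SlashAction.slash_mul]
    group

theorem isBoundedAtImInfty (hf : IsFormOfLevel N k f) : IsBoundedAtImInfty f := by
  simpa using hf.isBoundedAtImInfty_slash 1

theorem vadd_eq (hf : IsFormOfLevel N k f) (τ : ℍ) : f ((N : ℝ) +ᵥ τ) = f τ := by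
  have h := congrFun (hf.slash_eq (ModularGroup.T ^ (N : ℤ)) (by
    rw [CongruenceSubgroup.Gamma_mem, ModularGroup.coe_T_zpow]
    simp)) τ
  rw [slash_apply, ModularGroup.coe_T_zpow, UpperHalfPlane.modular_T_zpow_smul] at h
  simpa using h

theorem periodic (hf : IsFormOfLevel N k f) : Function.Periodic (f ∘ ofComplex) ((N : ℝ) : ℂ) := by
  intro w
  by_cases! hw : 0 < w.im
  · have : 0 < (w + ((N : ℝ) : ℂ)).im := by simp [hw]
    simp only [Function.comp_apply, ofComplex_apply_of_im_pos this, ofComplex_apply_of_im_pos hw]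
    rw [← hf.vadd_eq ⟨w, hw⟩]
    congr 1
    ext
    simp [add_comm]
  · have : (w + ((N : ℝ) : ℂ)).im ≤ 0 := by simpa using hw
    rw [Function.comp_apply, Function.comp_apply, ofComplex_apply_of_im_nonpos this,
      ofComplex_apply_of_im_nonpos hw]

theorem sub_valueAtInfty_isBigO (hf : IsFormOfLevel N k f) (hN : 0 < N) :
    (fun τ ↦ f τ - valueAtInfty f) =O[atImInfty] fun τ ↦ Real.exp (-2 * Real.pi * τ.im / N) :=
  exp_decay_sub_atImInfty (by exact_mod_cast hN) hf.periodic hf.mdifferentiable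
    hf.isBoundedAtImInfty

theorem tendsto_valueAtInfty (hf : IsFormOfLevel N k f) (hN : 0 < N) :
    Tendsto f atImInfty (𝓝 (valueAtInfty f)) := by
  simpa using ((hf.sub_valueAtInfty_isBigO hN).trans_tendsto
    (tendsto_exp_neg_two_pi_mul_im_div hN)).add_const (valueAtInfty f)

theorem differentiableOn (hf : IsFormOfLevel N k f) :
    DifferentiableOn ℂ (f ∘ ofComplex) {z | 0 < z.im} :=
  UpperHalfPlane.mdifferentiable_iff.mp hf.mdifferentiable

theorem fourierCoeff_zero (hf : IsFormOfLevel N k f) (hN : 0 < N) :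
    fourierCoeff N f 0 = valueAtInfty f := by
  have hN' : (0 : ℝ) < N := by exact_mod_cast hN
  exact qExpansion_coeff_zero hN' (analyticAt_cuspFunction_zero hN' hf.periodic
    hf.mdifferentiable hf.isBoundedAtImInfty) hf.periodic

end IsFormOfLevel

/-! ### Constant terms at the cusps. -/

theorem norm_e (z : ℂ) : ‖e z‖ = Real.exp (-2 * Real.pi * z.im) := by
  rw [e, Complex.norm_exp]
  congr 1
  simp [Complex.mul_re, Complex.mul_im]

theorem exists_SL_of_rat (x : ℚ) : ∃ δ : SL(2, ℤ), δ 0 0 = x.num ∧ δ 1 0 = (x.den : ℤ) := by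
  obtain ⟨u, v, huv⟩ := Rat.isCoprime_num_den x
  refine ⟨⟨!![x.num, -v; x.den, u], ?_⟩, rfl, rfl⟩
  rw [Matrix.det_fin_two_of]
  linarith

/-- Two elements of `SL(2, ℤ)` with the same first column differ by a translation. -/
theorem exists_eq_mul_T_zpow {δ ε : SL(2, ℤ)} (h0 : δ 0 0 = ε 0 0) (h1 : δ 1 0 = ε 1 0) :
    ∃ n : ℤ, ε = δ * ModularGroup.T ^ n := by
  have hm : (δ⁻¹ * ε) 1 0 = 0 := by
    rw [Matrix.SpecialLinearGroup.coe_mul, Matrix.SpecialLinearGroup.coe_inv,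
      Matrix.adjugate_fin_two, Matrix.mul_apply]
    simp [Fin.sum_univ_two, h0, h1]
    ring
  have hm' : (δ⁻¹ * ε) 0 0 = 1 := by
    have := δ.det_coe
    rw [Matrix.det_fin_two] at this
    rw [Matrix.SpecialLinearGroup.coe_mul, Matrix.SpecialLinearGroup.coe_inv,
      Matrix.adjugate_fin_two, Matrix.mul_apply]
    simp [Fin.sum_univ_two, ← h0, ← h1]
    linarith
  refine ⟨(δ⁻¹ * ε) 0 1, ?_⟩
  rw [← inv_mul_eq_iff_eq_mul]
  have hm2 : (δ⁻¹ * ε) 1 1 = 1 := by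
    have := (δ⁻¹ * ε).det_coe
    rw [Matrix.det_fin_two, hm, hm'] at this
    linarith
  ext i j
  rw [ModularGroup.coe_T_zpow]
  fin_cases i <;> fin_cases j <;> simp [hm, hm', hm2]

/-- The limit no longer involves `M`, so constants obtained with different `M` can be compared. -/
theorem IsCuspConstant.tendsto {k : ℕ} {f : ℍ → ℂ} {x : ℚ} {a : ℂ} (h : IsCuspConstant k f x a) :
    ∃ δ : SL(2, ℤ), δ 0 0 = x.num ∧ δ 1 0 = (x.den : ℤ) ∧
      Tendsto (f ∣[(k : ℤ)] δ) atImInfty (𝓝 a) := by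
  obtain ⟨δ, M, h0, h1, hM, hO⟩ := h
  refine ⟨δ, h0, h1, ?_⟩
  have h0 := hO.norm_right.trans_tendsto (f'' := fun τ ↦ (f ∣[(k : ℤ)] δ) τ - a) (by
    simp_rw [norm_e, Complex.div_natCast_im, ← mul_div_assoc]
    exact tendsto_exp_neg_two_pi_mul_im_div hM)
  simpa using h0.add_const a

namespace IsFormOfLevel

variable {N k : ℕ} {f : ℍ → ℂ}

theorem isCuspConstant (hf : IsFormOfLevel N k f) (hN : 0 < N) {x : ℚ} {δ : SL(2, ℤ)}
    (h0 : δ 0 0 = x.num) (h1 : δ 1 0 = (x.den : ℤ)) :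
    IsCuspConstant k f x (valueAtInfty (f ∣[(k : ℤ)] δ)) := by
  refine ⟨δ, N, h0, h1, hN, ?_⟩
  refine IsBigO.of_norm_right (g' := fun τ : ℍ ↦ e (τ / N)) ?_
  simp_rw [norm_e, Complex.div_natCast_im, ← mul_div_assoc]
  exact (hf.slash δ).sub_valueAtInfty_isBigO hN

/-- Two admissible matrices differ by some `T ^ n` on the right, which only translates `τ` and so
does not affect limits at `i∞`. -/
theorem eq_of_isCuspConstant {x : ℚ} {a b : ℂ}
    (ha : IsCuspConstant k f x a) (hb : IsCuspConstant k f x b) : a = b := by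
  obtain ⟨δ, h0, h1, hδ⟩ := ha.tendsto
  obtain ⟨ε, h0', h1', hε⟩ := hb.tendsto
  obtain ⟨n, rfl⟩ := exists_eq_mul_T_zpow (h0.trans h0'.symm) (h1.trans h1'.symm)
  have key : ∀ τ : ℍ, (f ∣[(k : ℤ)] (δ * ModularGroup.T ^ n)) τ
      = (f ∣[(k : ℤ)] δ) ((n : ℝ) +ᵥ τ) := by
    intro τ
    rw [SlashAction.slash_mul, slash_apply, ModularGroup.coe_T_zpow,
      UpperHalfPlane.modular_T_zpow_smul]
    simp
  refine tendsto_nhds_unique (hδ.comp (?_ : Tendsto (fun τ : ℍ ↦ (n : ℝ) +ᵥ τ) _ _))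
    (hε.congr key)
  rw [atImInfty, tendsto_comap_iff]
  refine tendsto_comap.congr fun τ ↦ ?_
  simp

theorem existsUnique_isCuspConstant (hf : IsFormOfLevel N k f) (hN : 0 < N) (x : ℚ) :
    ∃! a : ℂ, IsCuspConstant k f x a := by
  obtain ⟨δ, h0, h1⟩ := exists_SL_of_rat x
  exact ⟨_, hf.isCuspConstant hN h0 h1, fun b hb ↦
    eq_of_isCuspConstant hb (hf.isCuspConstant hN h0 h1)⟩

theorem cuspConstant_eq (hf : IsFormOfLevel N k f) (hN : 0 < N) {x : ℚ} {δ : SL(2, ℤ)}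
    (h0 : δ 0 0 = x.num) (h1 : δ 1 0 = (x.den : ℤ)) :
    cuspConstant k f x = valueAtInfty (f ∣[(k : ℤ)] δ) :=
  eq_of_isCuspConstant (Classical.epsilon_spec ⟨_, hf.isCuspConstant hN h0 h1⟩)
    (hf.isCuspConstant hN h0 h1)

end IsFormOfLevel

/-! ### Growth of the Fourier coefficients. -/

section CoefficientBound

open scoped Modular

/-- The primitive is an arctangent, of total variation below `π`; the bound is therefore uniform in
`d` and in the interval. -/
theorem intervalIntegral_inv_sq_add_sq_le {c : ℝ} (hc : 0 < c) (d : ℝ) {y : ℝ} (hy : 0 < y)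
    (a b : ℝ) :
    ∫ x in a..b, ((c * x + d) ^ 2 + c ^ 2 * y ^ 2)⁻¹ ≤ Real.pi / (c ^ 2 * y) := by
  have hpos : ∀ x : ℝ, 0 < (c * x + d) ^ 2 + c ^ 2 * y ^ 2 := fun x ↦ by positivity
  have hderiv : ∀ x ∈ Set.uIcc a b,
      HasDerivAt (fun x ↦ Real.arctan ((c * x + d) / (c * y)) / (c ^ 2 * y))
        (((c * x + d) ^ 2 + c ^ 2 * y ^ 2)⁻¹) x := by
    intro x _
    have h1 : HasDerivAt (fun x ↦ (c * x + d) / (c * y)) (c / (c * y)) x := by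
      simpa using (((hasDerivAt_id x).const_mul c).add_const d).div_const (c * y)
    convert! (h1.arctan).div_const (c ^ 2 * y) using 1
    have := (hpos x).ne'
    field_simp
    ring
  rw [intervalIntegral.integral_eq_sub_of_hasDerivAt hderiv]
  · rw [← sub_div]
    gcongr
    linarith [Real.arctan_lt_pi_div_two ((c * b + d) / (c * y)),
      Real.neg_pi_div_two_lt_arctan ((c * a + d) / (c * y))]
  · refine Continuous.intervalIntegrable ?_ _ _
    exact Continuous.inv₀ (by fun_prop) fun x ↦ (hpos x).ne'

namespace IsFormOfLevel

variable {N k : ℕ} {f : ℍ → ℂ}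

/-- A form of level `N` is bounded by the automorphy factor that moves the argument into the
fundamental domain of `SL(2, ℤ)`. -/
theorem exists_norm_le_div_denom (hf : IsFormOfLevel N k f) (hN : 0 < N) :
    ∃ C : ℝ, 0 ≤ C ∧ ∀ τ : ℍ, ∃ g : SL(2, ℤ), g • τ ∈ 𝒟 ∧
      ‖f τ‖ ≤ C / ‖(g 1 0 : ℂ) * τ + g 1 1‖ ^ k := by
  have : NeZero N := ⟨hN.ne'⟩
  have hslash : ∀ δ : SL(2, ℤ), ∃ C : ℝ, ∀ τ ∈ 𝒟, ‖(f ∣[(k : ℤ)] δ) τ‖ ≤ C := by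
    intro δ
    obtain ⟨C, hC⟩ := ModularGroup.exists_bound_fundamental_domain_of_isBigO (t := 0)
      (hf.slash δ).mdifferentiable.continuous
      (by simp only [Real.rpow_zero]; exact (hf.slash δ).isBoundedAtImInfty)
    exact ⟨C, by simpa using hC⟩
  -- `f ∣ δ` depends only on `δ` modulo `N`, so finitely many bounds on `𝒟` give a uniform one.
  have hred : ∀ δ ε : SL(2, ℤ),
      Matrix.SpecialLinearGroup.map (Int.castRingHom (ZMod N)) δ
        = Matrix.SpecialLinearGroup.map (Int.castRingHom (ZMod N)) ε →
      f ∣[(k : ℤ)] δ = f ∣[(k : ℤ)] ε := by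
    intro δ ε h
    have hmem : δ * ε⁻¹ ∈ CongruenceSubgroup.Gamma N := by
      rw [CongruenceSubgroup.Gamma, MonoidHom.mem_ker, map_mul, map_inv, h, mul_inv_cancel]
    calc f ∣[(k : ℤ)] δ = (f ∣[(k : ℤ)] (δ * ε⁻¹)) ∣[(k : ℤ)] ε := by
          rw [← SlashAction.slash_mul, inv_mul_cancel_right]
      _ = f ∣[(k : ℤ)] ε := by rw [hf.slash_eq _ hmem]
  have hfin : ∀ r : Matrix.SpecialLinearGroup (Fin 2) (ZMod N), ∃ C : ℝ, ∀ δ : SL(2, ℤ),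
      Matrix.SpecialLinearGroup.map (Int.castRingHom (ZMod N)) δ = r →
        ∀ τ ∈ 𝒟, ‖(f ∣[(k : ℤ)] δ) τ‖ ≤ C := by
    intro r
    by_cases hr : ∃ δ : SL(2, ℤ), Matrix.SpecialLinearGroup.map (Int.castRingHom (ZMod N)) δ = r
    · obtain ⟨δ, rfl⟩ := hr
      obtain ⟨C, hC⟩ := hslash δ
      exact ⟨C, fun ε hε ↦ by rwa [hred _ _ hε]⟩
    · exact ⟨0, fun δ hδ ↦ absurd ⟨δ, hδ⟩ hr⟩
  choose C hC using hfin
  obtain ⟨B, hB⟩ := Finite.exists_le C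
  refine ⟨max B 0, le_max_right _ _, fun τ ↦ ?_⟩
  obtain ⟨g, hg⟩ := ModularGroup.exists_smul_mem_fd τ
  refine ⟨g, hg, ?_⟩
  have h1 : f τ = ((f ∣[(k : ℤ)] g⁻¹) ∣[(k : ℤ)] g) τ := by
    rw [← SlashAction.slash_mul]
    simp
  rw [h1, slash_apply, norm_mul, norm_inv, norm_pow, ← div_eq_mul_inv]
  gcongr
  exact ((hC _ g⁻¹ rfl _ hg).trans (hB _)).trans (le_max_left _ _)

/-- Near the real line a form of level `N` is bounded by a finite sum of Eisenstein type. -/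
theorem exists_norm_le_sum (hf : IsFormOfLevel N k f) (hN : 0 < N) (hk : 2 ≤ k) :
    ∃ C : ℝ, 0 ≤ C ∧ ∀ n : ℕ, 3 ≤ n → ∀ τ : ℍ, τ.im = 1 / n → 0 ≤ τ.re → τ.re ≤ N →
      ‖f τ‖ ≤ C * (n : ℝ) ^ (k - 2) * ∑ c ∈ Finset.Icc (1 : ℕ) (2 * n),
        ∑ d ∈ Finset.Icc (-(c * N + 1 : ℤ)) (c * N + 1),
          ((c * τ.re + d) ^ 2 + (c : ℝ) ^ 2 * (1 / n) ^ 2)⁻¹ := by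
  obtain ⟨C, hC0, hC⟩ := hf.exists_norm_le_div_denom hN
  refine ⟨C, hC0, fun n hn τ him hre0 hre ↦ ?_⟩
  obtain ⟨g, hg, hle⟩ := hC τ
  have hn0 : (0 : ℝ) < n := by positivity
  have hn3 : (3 : ℝ) ≤ n := by exact_mod_cast hn
  set u : ℂ := (g 1 0 : ℂ) * τ + g 1 1 with hu
  have hsq : ‖u‖ ^ 2 = (g 1 0 * τ.re + g 1 1) ^ 2 + (g 1 0 : ℝ) ^ 2 * (1 / n) ^ 2 := by
    rw [← him, ← Complex.normSq_eq_norm_sq, hu, Complex.normSq_apply]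
    simp
    ring
  -- Points of `𝒟` have imaginary part at least `1/2`, while `Im (gτ) = Im τ / ‖u‖²`.
  have hle2 : ‖u‖ ^ 2 ≤ 2 * (1 / n) := by
    have h3 := ModularGroup.three_le_four_mul_im_sq_of_mem_fd hg
    have him' : (g • τ).im = (1 / n) / ‖u‖ ^ 2 := by
      rw [ModularGroup.im_smul_eq_div_normSq, him, ModularGroup.denom_apply,
        Complex.normSq_eq_norm_sq]
    have hpos : 0 < (g • τ).im := (g • τ).im_pos
    have hhalf : 1 / 2 ≤ (g • τ).im := by nlinarith
    have hu0 : 0 < ‖u‖ ^ 2 := by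
      by_contra h
      have : ‖u‖ ^ 2 = 0 := le_antisymm (not_lt.mp h) (by positivity)
      rw [him', this, div_zero] at hpos
      exact lt_irrefl _ hpos
    rw [him', le_div_iff₀ hu0] at hhalf
    linarith
  have hinv : 1 / (n : ℝ) ≤ 1 / 3 := one_div_le_one_div_of_le (by norm_num) hn3
  -- If `c = 0` then `‖u‖² = d² ≥ 1`, against `‖u‖² ≤ 2/3`; this is where `n ≥ 3` enters.
  have hc : g 1 0 ≠ 0 := by
    intro hc
    have hd : g 1 1 ≠ 0 := by
      intro hd
      have := g.det_coe
      rw [Matrix.det_fin_two, hc, hd] at this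
      simp at this
    have : (1 : ℝ) ≤ (g 1 1 : ℝ) ^ 2 := by
      exact_mod_cast (one_le_sq_iff_one_le_abs _).mpr (Int.one_le_abs hd)
    rw [hc] at hsq
    simp at hsq
    nlinarith
  have hc1 : (1 : ℝ) ≤ (g 1 0 : ℝ) ^ 2 := by
    exact_mod_cast (one_le_sq_iff_one_le_abs _).mpr (Int.one_le_abs hc)
  -- This bounds the surplus factor `‖u‖^(-(k-2))` by `n^(k-2)`; the remaining `‖u‖^(-2)` is kept
  -- for integration over a period.
  have hun : 1 / (n : ℝ) ≤ ‖u‖ := by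
    refine le_of_sq_le_sq ?_ (norm_nonneg _)
    rw [hsq]
    nlinarith [sq_nonneg ((g 1 0 : ℝ) * τ.re + g 1 1), sq_nonneg (1 / (n : ℝ))]
  have hcn : (g 1 0).natAbs ≤ 2 * n := by
    have h1 : (g 1 0 : ℝ) ^ 2 * (1 / n) ^ 2 ≤ 2 * (1 / n) := by
      nlinarith [sq_nonneg ((g 1 0 : ℝ) * τ.re + g 1 1)]
    have h2 : (g 1 0 : ℝ) ^ 2 ≤ 2 * n := by
      have := mul_le_mul_of_nonneg_right h1 (sq_nonneg (n : ℝ))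
      field_simp at this
      linarith
    have h3 : ((g 1 0).natAbs : ℝ) ^ 2 ≤ 2 * n := by
      rw [Nat.cast_natAbs, Int.cast_abs, sq_abs]
      exact h2
    have h4 : (g 1 0).natAbs ^ 2 ≤ 2 * n := by exact_mod_cast h3
    nlinarith [Nat.le_self_pow two_ne_zero (g 1 0).natAbs]
  -- `‖u‖` is unchanged under `(c, d) ↦ (-c, -d)`, so the sum needs only `c > 0`.
  obtain ⟨s, hs, hcs⟩ : ∃ s : ℤ, (s = 1 ∨ s = -1) ∧ ((g 1 0).natAbs : ℤ) = s * g 1 0 := by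
    rcases Int.natAbs_eq (g 1 0) with h | h
    · exact ⟨1, Or.inl rfl, by omega⟩
    · exact ⟨-1, Or.inr rfl, by omega⟩
  have hsR : (s : ℝ) ^ 2 = 1 := by rcases hs with rfl | rfl <;> norm_num
  have hcR : ((g 1 0).natAbs : ℝ) = s * g 1 0 := by
    rw [← Int.cast_natCast, hcs, Int.cast_mul]
  have hterm : ‖u‖ ^ 2 = ((g 1 0).natAbs * τ.re + (s * g 1 1 : ℤ)) ^ 2
      + ((g 1 0).natAbs : ℝ) ^ 2 * (1 / n) ^ 2 := by
    rw [hsq, hcR]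
    push_cast
    linear_combination (-((g 1 0 : ℝ) * τ.re + g 1 1) ^ 2
      - (g 1 0 : ℝ) ^ 2 * (1 / (n : ℝ)) ^ 2) * hsR
  have hdmem : s * g 1 1 ∈ Finset.Icc (-((g 1 0).natAbs * N + 1 : ℤ))
      ((g 1 0).natAbs * N + 1) := by
    have h1 : ((g 1 0).natAbs * τ.re + (s * g 1 1 : ℤ)) ^ 2 ≤ 1 := by
      nlinarith [mul_nonneg (sq_nonneg ((g 1 0).natAbs : ℝ)) (sq_nonneg (1 / (n : ℝ)))]
    have h2 := abs_le.mp ((sq_le_one_iff_abs_le_one _).mp h1)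
    have h3 : ((g 1 0).natAbs : ℝ) * τ.re ≤ (g 1 0).natAbs * N := by gcongr
    have h4 : 0 ≤ ((g 1 0).natAbs : ℝ) * τ.re := by positivity
    rw [Finset.mem_Icc]
    constructor
    · have : (-((g 1 0).natAbs * N + 1) : ℝ) ≤ (s * g 1 1 : ℤ) := by linarith
      exact_mod_cast this
    · have : ((s * g 1 1 : ℤ) : ℝ) ≤ (g 1 0).natAbs * N + 1 := by
        have : (0 : ℝ) ≤ (g 1 0).natAbs * N := by positivity
        linarith
      rw [← Int.cast_natCast] at this
      exact_mod_cast this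
  have hcmem : (g 1 0).natAbs ∈ Finset.Icc 1 (2 * n) :=
    Finset.mem_Icc.mpr ⟨Int.natAbs_pos.mpr hc, hcn⟩
  have hu0 : 0 < ‖u‖ := lt_of_lt_of_le (by positivity) hun
  calc ‖f τ‖ ≤ C / ‖u‖ ^ k := hle
    _ = C * (‖u‖⁻¹) ^ (k - 2) * (‖u‖ ^ 2)⁻¹ := by
      rw [div_eq_mul_inv, mul_assoc, inv_pow, ← mul_inv, ← pow_add, Nat.sub_add_cancel hk]
    _ ≤ C * (n : ℝ) ^ (k - 2) * (‖u‖ ^ 2)⁻¹ := by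
      gcongr
      rw [inv_le_comm₀ hu0 hn0]
      simpa using hun
    _ ≤ _ := by
      refine mul_le_mul_of_nonneg_left ?_ (by positivity)
      rw [hterm]
      refine le_trans ?_ (Finset.single_le_sum (f := fun c : ℕ ↦
        ∑ d ∈ Finset.Icc (-(c * N + 1 : ℤ)) (c * N + 1),
          ((c * τ.re + d) ^ 2 + (c : ℝ) ^ 2 * (1 / n) ^ 2)⁻¹)
        (fun c _ ↦ Finset.sum_nonneg fun d _ ↦ by positivity) hcmem)
      exact Finset.single_le_sum (f := fun d : ℤ ↦
          (((g 1 0).natAbs * τ.re + d) ^ 2 + ((g 1 0).natAbs : ℝ) ^ 2 * (1 / (n : ℝ)) ^ 2)⁻¹)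
        (fun d _ ↦ by positivity) hdmem

/-- The coefficient integral is taken at height `1/n`, where `|q^(1/N)|^(-n)` is the constant
`exp(2π/N)`. Each pair `(c, d)` contributes at most `πn/c²`, and there are `O(c)` values of `d`,
which gives `n^(k-1)` times a harmonic sum. The pointwise bound `|f| ≪ (Im τ)^(-k)` would only give
`n^k`. -/
theorem norm_fourierCoeff_le (hf : IsFormOfLevel N k f) (hN : 0 < N) (hk : 2 ≤ k) {ε : ℝ}
    (hε : 0 < ε) :
    ∃ K : ℝ, ∀ n : ℕ, 3 ≤ n → ‖fourierCoeff N f n‖ ≤ K * (n : ℝ) ^ ((k : ℝ) - 1 + ε) := by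
  obtain ⟨C, hC0, hC⟩ := hf.exists_norm_le_sum hN hk
  have hN' : (0 : ℝ) < N := by exact_mod_cast hN
  have hsum : Summable fun c : ℕ ↦ (c : ℝ) ^ (-(1 + ε)) :=
    Real.summable_nat_rpow.mpr (by linarith)
  set Z := ∑' c : ℕ, (c : ℝ) ^ (-(1 + ε)) with hZ
  refine ⟨1 / N * Real.exp (2 * Real.pi / N) * C * ((2 * N + 3) * Real.pi * 2 ^ ε * Z),
    fun n hn ↦ ?_⟩
  have hn0 : (0 : ℝ) < n := by positivity
  have hy : 0 < 1 / (n : ℝ) := by positivity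
  set S : ℝ → ℝ := fun x ↦ ∑ c ∈ Finset.Icc (1 : ℕ) (2 * n),
        ∑ d ∈ Finset.Icc (-(c * N + 1 : ℤ)) (c * N + 1),
          ((c * x + d) ^ 2 + (c : ℝ) ^ 2 * (1 / n) ^ 2)⁻¹ with hS
  have hcont : ∀ c ∈ Finset.Icc (1 : ℕ) (2 * n), ∀ d : ℤ,
      Continuous fun x : ℝ ↦ ((c * x + d) ^ 2 + (c : ℝ) ^ 2 * (1 / n) ^ 2)⁻¹ := by
    intro c hc d
    have hc0 : (0 : ℝ) < c := by exact_mod_cast (Finset.mem_Icc.mp hc).1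
    exact Continuous.inv₀ (by fun_prop) fun x ↦ by positivity
  have hScont : Continuous S := continuous_finsetSum _ fun c hc ↦
    continuous_finsetSum _ fun d _ ↦ hcont c hc d
  have hSint : ∫ x in (0 : ℝ)..N, S x ≤ (2 * N + 3) * Real.pi * n * ((2 * n) ^ ε * Z) := by
    rw [intervalIntegral.integral_finsetSum]
    swap
    · exact fun c hc ↦ (continuous_finsetSum _ fun d _ ↦ hcont c hc d).intervalIntegrable _ _
    calc _ ≤ ∑ c ∈ Finset.Icc (1 : ℕ) (2 * n),
          (2 * N + 3) * Real.pi * n * ((2 * n) ^ ε * (c : ℝ) ^ (-(1 + ε))) := by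
          refine Finset.sum_le_sum fun c hc ↦ ?_
          have hc1 : (1 : ℝ) ≤ c := by exact_mod_cast (Finset.mem_Icc.mp hc).1
          have hc2 : (c : ℝ) ≤ 2 * n := by exact_mod_cast (Finset.mem_Icc.mp hc).2
          have hc0 : (0 : ℝ) < c := by linarith
          rw [intervalIntegral.integral_finsetSum fun d _ ↦ (hcont c hc d).intervalIntegrable _ _]
          calc _ ≤ ∑ d ∈ Finset.Icc (-(c * N + 1 : ℤ)) (c * N + 1),
                Real.pi / ((c : ℝ) ^ 2 * (1 / n)) :=
                Finset.sum_le_sum fun d _ ↦ intervalIntegral_inv_sq_add_sq_le hc0 d hy _ _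
            _ = (2 * (c * N) + 3) * (Real.pi / ((c : ℝ) ^ 2 * (1 / n))) := by
                rw [Finset.sum_const, Int.card_Icc, nsmul_eq_mul]
                congr 1
                have : ((c * N + 1 : ℤ) + 1 - (-(c * N + 1 : ℤ))).toNat = 2 * (c * N) + 3 := by
                  zify
                  have : (0 : ℤ) ≤ c * N := by positivity
                  rw [Int.toNat_of_nonneg (by linarith)]
                  ring
                rw [this]
                push_cast
                ring
            _ ≤ ((2 * N + 3) * c) * (Real.pi / ((c : ℝ) ^ 2 * (1 / n))) := by
                gcongr
                nlinarith
            _ = (2 * N + 3) * Real.pi * n * (c : ℝ)⁻¹ := by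
                field_simp
            _ ≤ _ := by
                have h1 : (c : ℝ) ^ ε ≤ (2 * n) ^ ε := Real.rpow_le_rpow hc0.le hc2 hε.le
                -- Paying `c^ε ≤ (2n)^ε` replaces the harmonic sum by the convergent series `Z`.
                have h2 : (c : ℝ)⁻¹ = (c : ℝ) ^ ε * (c : ℝ) ^ (-(1 + ε)) := by
                  rw [← Real.rpow_add hc0, ← Real.rpow_neg_one]
                  ring_nf
                rw [h2]
                gcongr
      _ = (2 * N + 3) * Real.pi * n * ((2 * n) ^ ε *
          ∑ c ∈ Finset.Icc (1 : ℕ) (2 * n), (c : ℝ) ^ (-(1 + ε))) := by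
          rw [Finset.mul_sum, Finset.mul_sum]
      _ ≤ _ := by
          gcongr
          exact hsum.sum_le_tsum _ fun c _ ↦ by positivity
  have hcoef : ‖fourierCoeff N f n‖ ≤ 1 / N * (Real.exp (2 * Real.pi / N) *
      (C * (n : ℝ) ^ (k - 2) * ∫ x in (0 : ℝ)..N, S x)) := by
    rw [fourierCoeff, qExpansion_coeff_eq_intervalIntegral hN' hf.periodic hf.mdifferentiable
      hf.isBoundedAtImInfty n hy, norm_mul]
    refine mul_le_mul (by simp) ?_ (norm_nonneg _) (by positivity)
    rw [← intervalIntegral.integral_const_mul, ← intervalIntegral.integral_const_mul]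
    refine intervalIntegral.norm_integral_le_of_norm_le hN'.le ?_ ?_
    · refine MeasureTheory.ae_of_all _ fun x hx ↦ ?_
      rw [norm_mul, norm_div, norm_one, norm_pow, Function.Periodic.norm_qParam,
        ← Real.exp_nat_mul, one_div, ← Real.exp_neg]
      have hτ : 0 < ((x : ℂ) + ((1 / n : ℝ) : ℂ) * Complex.I).im := by simpa using hn0
      have hre : (⟨(x : ℂ) + ((1 / n : ℝ) : ℂ) * Complex.I, hτ⟩ : ℍ).re = x := by
        rw [← coe_re]
        simp
      have him : (⟨(x : ℂ) + ((1 / n : ℝ) : ℂ) * Complex.I, hτ⟩ : ℍ).im = 1 / n := by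
        rw [← coe_im]
        simp
      have hle := hC n hn _ him (hre.symm ▸ hx.1.le) (hre.symm ▸ hx.2)
      rw [hre] at hle
      refine mul_le_mul ?_ hle (norm_nonneg _) (Real.exp_pos _).le
      refine (congrArg Real.exp ?_).le
      simp
      field_simp
    · exact (Continuous.intervalIntegrable (by fun_prop) _ _)
  refine hcoef.trans ?_
  calc _ ≤ 1 / N * (Real.exp (2 * Real.pi / N) * (C * (n : ℝ) ^ (k - 2) *
        ((2 * N + 3) * Real.pi * n * ((2 * n) ^ ε * Z)))) := by gcongr
    _ = _ := by
      rw [Real.mul_rpow (by norm_num) hn0.le]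
      have : (n : ℝ) ^ ((k : ℝ) - 1 + ε) = (n : ℝ) ^ (k - 2) * n * (n : ℝ) ^ ε := by
        rw [Real.rpow_add hn0, ← pow_succ, ← Real.rpow_natCast]
        congr 2
        rw [Nat.cast_add, Nat.cast_sub hk]
        push_cast
        ring
      rw [this]
      ring

/-- Up to an arbitrarily small power, the Fourier coefficients grow at most like `n ^ (k - 1)`. -/
theorem fourierCoeff_isBigO (hf : IsFormOfLevel N k f) (hN : 0 < N) (hk : 2 ≤ k) {ε : ℝ}
    (hε : 0 < ε) :
    (fourierCoeff N f) =O[atTop] fun n : ℕ ↦ (n : ℝ) ^ ((k : ℝ) - 1 + ε) := by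
  obtain ⟨K, hK⟩ := hf.norm_fourierCoeff_le hN hk hε
  refine IsBigO.of_bound K ?_
  filter_upwards [eventually_ge_atTop 3] with n hn
  rw [Real.norm_of_nonneg (by positivity)]
  exact hK n hn

end IsFormOfLevel

end CoefficientBound

open Set

/-! ### Möbius action on complex coordinates. -/

section Moebius

/-- The Möbius transformation of `ℂ` given by an integral matrix. -/
noncomputable def moebius (δ : SL(2, ℤ)) (z : ℂ) : ℂ :=
  ((δ 0 0 : ℂ) * z + δ 0 1) / ((δ 1 0 : ℂ) * z + δ 1 1)

theorem det_complex (δ : SL(2, ℤ)) : (δ 0 0 : ℂ) * δ 1 1 - δ 0 1 * δ 1 0 = 1 := by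
  have := δ.det_coe
  rw [Matrix.det_fin_two] at this
  exact_mod_cast this

theorem denom_ne_zero_of_im_pos (δ : SL(2, ℤ)) {z : ℂ} (hz : 0 < z.im) :
    (δ 1 0 : ℂ) * z + δ 1 1 ≠ 0 := by
  have := UpperHalfPlane.denom_ne_zero (δ : GL (Fin 2) ℝ) ⟨z, hz⟩
  rwa [ModularGroup.denom_apply] at this

theorem coe_smul_ofComplex (δ : SL(2, ℤ)) {z : ℂ} (hz : 0 < z.im) :
    ((δ • ofComplex z : ℍ) : ℂ) = moebius δ z := by
  rw [coe_specialLinearGroup_apply, ofComplex_apply_of_im_pos hz]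
  simp [moebius]

theorem im_moebius_pos (δ : SL(2, ℤ)) {z : ℂ} (hz : 0 < z.im) : 0 < (moebius δ z).im := by
  rw [← coe_smul_ofComplex δ hz]
  exact (δ • ofComplex z).im_pos

theorem ofComplex_moebius (δ : SL(2, ℤ)) {z : ℂ} (hz : 0 < z.im) :
    ofComplex (moebius δ z) = δ • ofComplex z := by
  rw [← coe_smul_ofComplex δ hz, ofComplex_apply]

theorem moebius_mul (δ ε : SL(2, ℤ)) {z : ℂ} (hz : 0 < z.im) :
    moebius (δ * ε) z = moebius δ (moebius ε z) := by
  rw [← coe_smul_ofComplex _ hz, mul_smul, ← ofComplex_moebius ε hz,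
    coe_smul_ofComplex δ (im_moebius_pos ε hz)]

theorem hasDerivAt_moebius (δ : SL(2, ℤ)) {z : ℂ} (hz : (δ 1 0 : ℂ) * z + δ 1 1 ≠ 0) :
    HasDerivAt (moebius δ) (((δ 1 0 : ℂ) * z + δ 1 1) ^ 2)⁻¹ z := by
  have h1 : HasDerivAt (fun z : ℂ ↦ (δ 0 0 : ℂ) * z + δ 0 1) (δ 0 0 : ℂ) z := by
    simpa using ((hasDerivAt_id z).const_mul (δ 0 0 : ℂ)).add_const (δ 0 1 : ℂ)
  have h2 : HasDerivAt (fun z : ℂ ↦ (δ 1 0 : ℂ) * z + δ 1 1) (δ 1 0 : ℂ) z := by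
    simpa using ((hasDerivAt_id z).const_mul (δ 1 0 : ℂ)).add_const (δ 1 1 : ℂ)
  convert! h1.div h2 hz using 1
  rw [inv_eq_one_div]
  congr 1
  linear_combination -det_complex δ

theorem comp_ofComplex_moebius (k : ℕ) (f : ℍ → ℂ) (δ : SL(2, ℤ)) {z : ℂ} (hz : 0 < z.im) :
    f (ofComplex (moebius δ z))
      = ((δ 1 0 : ℂ) * z + δ 1 1) ^ k * (f ∣[(k : ℤ)] δ) (ofComplex z) := by
  have h := denom_ne_zero_of_im_pos δ hz
  rw [slash_apply, ofComplex_moebius δ hz, ofComplex_apply_of_im_pos hz]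
  field_simp

/-- The vertical line through the cusp `δ ∞` is the image under `δ` of a vertical line. -/
theorem moebius_vertical (δ : SL(2, ℤ)) (hδ : δ 1 0 ≠ 0) {t : ℝ} (ht : t ≠ 0) :
    moebius δ ((-(δ 1 1 : ℝ) / δ 1 0 : ℝ) + (t / (δ 1 0 : ℝ) ^ 2 : ℝ) * Complex.I)
      = ((δ 0 0 : ℝ) / δ 1 0 : ℝ) + (1 / t : ℝ) * Complex.I := by
  have hp : (δ 1 0 : ℂ) ≠ 0 := by exact_mod_cast hδ
  have ht' : (t : ℂ) ≠ 0 := by exact_mod_cast ht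
  have hd := det_complex δ
  have hden : (δ 1 0 : ℂ) * ((-(δ 1 1 : ℝ) / δ 1 0 : ℝ) + (t / (δ 1 0 : ℝ) ^ 2 : ℝ) * Complex.I)
      + δ 1 1 = t * Complex.I / δ 1 0 := by
    push_cast
    field_simp
    ring
  rw [moebius, hden, div_eq_iff (by simp [hp, ht', Complex.I_ne_zero])]
  push_cast
  field_simp
  linear_combination (-(δ 1 0 : ℂ)) * hd - (δ 1 0 : ℂ) * Complex.I_sq

end Moebius

/-! ### Restriction to vertical lines and the functional equation. -/

section Vertical

theorem im_vertical (x t : ℝ) : ((x : ℂ) + (t : ℂ) * Complex.I).im = t := by simp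

theorem tendsto_ofComplex_vertical (x : ℝ) {c : ℝ} (hc : 0 < c) :
    Tendsto (fun t : ℝ ↦ ofComplex (x + (c * t : ℝ) * Complex.I)) atTop atImInfty := by
  rw [atImInfty, tendsto_comap_iff]
  refine (tendsto_id.const_mul_atTop hc).congr' ?_
  filter_upwards [eventually_gt_atTop 0] with t ht
  have : 0 < ((x : ℂ) + (c * t : ℝ) * Complex.I).im := by simpa using mul_pos hc ht
  rw [Function.comp_apply, ofComplex_apply_of_im_pos this, ← coe_im]
  simp

namespace IsFormOfLevel

variable {N k : ℕ} {f : ℍ → ℂ}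

theorem continuousOn_vertical (hf : IsFormOfLevel N k f) (x : ℝ) {c : ℝ} (hc : 0 < c) :
    ContinuousOn (fun t : ℝ ↦ f (ofComplex (x + (c * t : ℝ) * Complex.I))) (Ioi 0) := by
  refine hf.differentiableOn.continuousOn.comp (by fun_prop) fun t (ht : 0 < t) ↦ ?_
  simpa using mul_pos hc ht

theorem exp_decay_vertical (hf : IsFormOfLevel N k f) (hN : 0 < N) (x : ℝ) {c : ℝ} (hc : 0 < c) :
    ∃ b > 0, (fun t : ℝ ↦ f (ofComplex (x + (c * t : ℝ) * Complex.I)) - valueAtInfty f)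
      =O[atTop] fun t ↦ Real.exp (-b * t) := by
  have hN' : (0 : ℝ) < N := by exact_mod_cast hN
  refine ⟨2 * Real.pi * c / N, by have := Real.pi_pos; positivity, ?_⟩
  refine ((hf.sub_valueAtInfty_isBigO hN).comp_tendsto
    (tendsto_ofComplex_vertical x hc)).trans_eventuallyEq ?_
  filter_upwards [eventually_gt_atTop 0] with t ht
  have : 0 < ((x : ℂ) + (c * t : ℝ) * Complex.I).im := by simpa using mul_pos hc ht
  rw [Function.comp_apply, ofComplex_apply_of_im_pos this, ← coe_im]
  congr 1
  simp
  ring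

theorem rpow_decay_vertical (hf : IsFormOfLevel N k f) (hN : 0 < N) (x : ℝ) {c : ℝ} (hc : 0 < c)
    (r : ℝ) :
    (fun t : ℝ ↦ f (ofComplex (x + (c * t : ℝ) * Complex.I)) - valueAtInfty f)
      =O[atTop] fun t ↦ t ^ r := by
  obtain ⟨b, hb, h⟩ := hf.exp_decay_vertical hN x hc
  exact h.trans (isLittleO_exp_neg_mul_rpow_atTop hb r).isBigO

/-- The pair of functions whose Mellin transforms are related by `δ`: the restriction of `f` to
the vertical line through the cusp `δ ∞`, and the restriction of `f ∣ δ` to the corresponding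
vertical line. -/
noncomputable def fePair (hf : IsFormOfLevel N k f) (hN : 0 < N) (hk : 0 < k) (δ : SL(2, ℤ))
    (hδ : δ 1 0 ≠ 0) : WeakFEPair ℂ where
  f t := f (ofComplex (((δ 0 0 : ℝ) / δ 1 0 : ℝ) + (1 * t : ℝ) * Complex.I))
  g t := (f ∣[(k : ℤ)] δ) (ofComplex
    ((-(δ 1 1 : ℝ) / δ 1 0 : ℝ) + (1 / (δ 1 0 : ℝ) ^ 2 * t : ℝ) * Complex.I))
  k := k
  ε := (Complex.I / δ 1 0) ^ k
  f₀ := valueAtInfty f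
  g₀ := valueAtInfty (f ∣[(k : ℤ)] δ)
  hf_int := (hf.continuousOn_vertical _ one_pos).locallyIntegrableOn measurableSet_Ioi
  hg_int := ((hf.slash δ).continuousOn_vertical _ (by positivity)).locallyIntegrableOn
    measurableSet_Ioi
  hk := by exact_mod_cast hk
  hε := pow_ne_zero _ (div_ne_zero Complex.I_ne_zero (by exact_mod_cast hδ))
  -- By `moebius_vertical` the point over `δ∞` at height `1/t` is the image of one where the
  -- automorphy factor is `it/δ₁₀`; its `k`-th power is `ε t^k`.
  h_feq t (ht : 0 < t) := by
    have hz : 0 < ((((-(δ 1 1 : ℝ) / δ 1 0 : ℝ) : ℂ) +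
        (t / (δ 1 0 : ℝ) ^ 2 : ℝ) * Complex.I)).im := by
      rw [im_vertical]
      positivity
    have hp : (δ 1 0 : ℂ) ≠ 0 := by exact_mod_cast hδ
    rw [one_mul, ← moebius_vertical δ hδ ht.ne', comp_ofComplex_moebius k f δ hz, smul_eq_mul,
      Real.rpow_natCast, one_div_mul_eq_div, Complex.ofReal_pow, ← mul_pow]
    congr 2
    push_cast
    field_simp
    ring
  hf_top r := hf.rpow_decay_vertical hN _ one_pos r
  hg_top r := (hf.slash δ).rpow_decay_vertical hN _ (by positivity) r

end IsFormOfLevel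

end Vertical

/-! ### The twisted series as a Mellin transform. -/

section Series

namespace IsFormOfLevel

variable {N k : ℕ} {f : ℍ → ℂ}

theorem norm_twistedCoeff (N : ℕ) (f : ℍ → ℂ) (y : ℚ) (n : ℕ) :
    ‖twistedCoeff N f y n‖ = ‖fourierCoeff N f n‖ := by
  have : ((n : ℂ) * y / N).im = 0 := by
    have : (n : ℂ) * y / N = ((n * y / N : ℝ) : ℂ) := by push_cast; rfl
    rw [this, Complex.ofReal_im]
  rw [twistedCoeff, norm_mul, norm_e, this]
  simp

theorem lseriesSummable_twistedCoeff (hf : IsFormOfLevel N k f) (hN : 0 < N) (hk : 2 ≤ k) (y : ℚ)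
    {s : ℂ} (hs : k < s.re) : LSeriesSummable (twistedCoeff N f y) s := by
  -- The criterion asks for coefficients `O(n^(x-1))` with `x < Re s`; the midpoint of `k` and `Re
  -- s` leaves room for `ε`.
  refine LSeriesSummable_of_isBigO_rpow (x := k + (s.re - k) / 2) (by linarith) ?_
  refine IsBigO.of_norm_left ?_
  simp_rw [norm_twistedCoeff]
  refine (hf.fourierCoeff_isBigO hN hk (ε := (s.re - k) / 2) (by linarith)).norm_left.congr_right ?_
  intro n
  ring_nf

/-- Evaluating the `q`-expansion at `y + it` produces the twist `e(ny/N)`; dropping `n = 0` removes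
the constant term. -/
theorem hasSum_vertical (hf : IsFormOfLevel N k f) (hN : 0 < N) (y : ℚ) {t : ℝ} (ht : 0 < t) :
    HasSum (fun n : ℕ ↦ (if n = 0 then 0 else twistedCoeff N f y n) *
      (Real.exp (-(2 * Real.pi * n / N) * t) : ℂ))
      (f (ofComplex ((y : ℝ) + (1 * t : ℝ) * Complex.I)) - valueAtInfty f) := by
  have hN' : (0 : ℝ) < N := by exact_mod_cast hN
  have him : 0 < ((y : ℝ) + (1 * t : ℝ) * Complex.I : ℂ).im := by simpa using ht
  have h := hasSum_qExpansion hN' hf.periodic hf.mdifferentiable hf.isBoundedAtImInfty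
    (ofComplex ((y : ℝ) + (1 * t : ℝ) * Complex.I))
  rw [ofComplex_apply_of_im_pos him] at h ⊢
  convert! hasSum_ite_sub_hasSum h 0 using 2 with n
  · split_ifs with hn
    · simp
    · rw [twistedCoeff, e, smul_eq_mul, Function.Periodic.qParam, ← Complex.exp_nat_mul, mul_assoc,
        Complex.ofReal_exp, ← Complex.exp_add, fourierCoeff]
      congr 2
      have : (N : ℂ) ≠ 0 := by exact_mod_cast hN.ne'
      push_cast
      field_simp
      linear_combination (-(t : ℂ)) * Complex.I_sq
  · rw [pow_zero, smul_eq_mul, mul_one]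
    exact (hf.fourierCoeff_zero hN).symm

theorem mellin_vertical (hf : IsFormOfLevel N k f) (hN : 0 < N) (hk : 2 ≤ k) (y : ℚ)
    {s : ℂ} (hs : k < s.re) :
    mellin (fun t ↦ f (ofComplex ((y : ℝ) + (1 * t : ℝ) * Complex.I)) - valueAtInfty f) s
      = (2 * Real.pi : ℂ) ^ (-s) * Complex.Gamma s * twistedLSeries N f y s := by
  have hN' : (0 : ℝ) < N := by exact_mod_cast hN
  have hs0 : 0 < s.re := lt_of_le_of_lt (by positivity) hs
  have hcpow : ∀ n : ℕ, ((2 * Real.pi * n / N : ℝ) : ℂ) ^ s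
      = (2 * Real.pi : ℂ) ^ s * (n : ℂ) ^ s / (N : ℂ) ^ s := by
    intro n
    rw [Complex.ofReal_div, Complex.div_cpow_ofReal_nonneg (by positivity) hN'.le,
      Complex.ofReal_mul, Complex.mul_cpow_ofReal_nonneg (by positivity) (by positivity)]
    simp
  have hterm : ∀ n : ℕ, Complex.Gamma s * (if n = 0 then 0 else twistedCoeff N f y n) /
      ((2 * Real.pi * n / N : ℝ) : ℂ) ^ s =
      (2 * Real.pi : ℂ) ^ (-s) * Complex.Gamma s * (N : ℂ) ^ s *
        LSeries.term (twistedCoeff N f y) s n := by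
    intro n
    rcases eq_or_ne n 0 with rfl | hn
    · simp
    · rw [if_neg hn, LSeries.term_of_ne_zero hn, hcpow, Complex.cpow_neg]
      field_simp
  have hsummable := hf.lseriesSummable_twistedCoeff hN hk y hs
  have h := hasSum_mellin (a := fun n : ℕ ↦ if n = 0 then 0 else twistedCoeff N f y n)
    (p := fun n : ℕ ↦ 2 * Real.pi * n / N) (s := s)
    (fun n ↦ by
      rcases Nat.eq_zero_or_pos n with rfl | hn
      · exact Or.inl (if_pos rfl)
      · right
        have := Real.pi_pos
        positivity) hs0 (fun t ht ↦ hf.hasSum_vertical hN y ht) (by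
      have hn := (hsummable.mul_left
        ((2 * Real.pi : ℂ) ^ (-s) * (N : ℂ) ^ s)).norm
      refine hn.congr fun n ↦ ?_
      rcases Nat.eq_zero_or_pos n with rfl | hn
      · simp
      · have hpos : (0 : ℝ) < 2 * Real.pi * n / N := by
          have := Real.pi_pos
          positivity
        rw [if_neg hn.ne', ← Complex.norm_cpow_eq_rpow_re_of_pos hpos, hcpow, ← norm_div,
          LSeries.term_of_ne_zero hn.ne', Complex.cpow_neg]
        congr 1
        field_simp)
  simp_rw [hterm] at h
  rw [← h.tsum_eq, tsum_mul_left, twistedLSeries, LSeries]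
  ring

end IsFormOfLevel

end Series

/-! ### Continuation of the completed function and independence of the vertical line. -/

section Completion

/-- `completedTwistedL` is an arbitrary choice; this lets its values be read off from any explicit
continuation. The plane minus two points is connected, so agreement near `k + 1` propagates. -/
theorem IsCompletedTwistedL.eq_of_ne {N k : ℕ} {f : ℍ → ℂ} {y : ℚ} {Λ Λ' : ℂ → ℂ}
    (h : IsCompletedTwistedL N k f y Λ) (h' : IsCompletedTwistedL N k f y Λ') {s : ℂ}
    (hs0 : s ≠ 0) (hsk : s ≠ k) : Λ s = Λ' s := by
  have hopen : IsOpen ({0, (k : ℂ)}ᶜ : Set ℂ) :=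
    ((Set.finite_singleton _).insert _).isClosed.isOpen_compl
  have hconn : IsPreconnected ({0, (k : ℂ)}ᶜ : Set ℂ) :=
    (((Set.finite_singleton _).insert _).countable.isConnected_compl_of_one_lt_rank
      (by simp [Complex.rank_real_complex])).isPreconnected
  refine (h.differentiableOn.analyticOnNhd hopen).eqOn_of_preconnected_of_eventuallyEq
    (h'.differentiableOn.analyticOnNhd hopen) hconn (z₀ := (k : ℂ) + 1) ?_ ?_ ?_
  · simp only [mem_compl_iff, mem_insert_iff, mem_singleton_iff, not_or]
    exact ⟨by exact_mod_cast k.succ_ne_zero, by simp⟩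
  · have : ∀ᶠ z : ℂ in 𝓝 ((k : ℂ) + 1), (k : ℝ) < z.re :=
      (isOpen_lt continuous_const Complex.continuous_re).mem_nhds (by simp)
    filter_upwards [this] with z hz
    rw [h.eq_series z hz, h'.eq_series z hz]
  · simp [hs0, hsk]

namespace IsFormOfLevel

variable {N k : ℕ} {f : ℍ → ℂ}

/-- Only the ratio of the first column of `δ` is prescribed, with no sign or normalization; `γ * δ`
and `γ⁻¹` are used later, and their lower left entries may be negative. -/
theorem isCompletedTwistedL_fePair (hf : IsFormOfLevel N k f) (hN : 0 < N) (hk : 2 ≤ k) {y : ℚ}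
    {δ : SL(2, ℤ)} (hδ : δ 1 0 ≠ 0) (hy : (y : ℝ) = (δ 0 0 : ℝ) / δ 1 0) :
    IsCompletedTwistedL N k f y
      fun s ↦ -e (-s / 4) * (hf.fePair hN (by omega) δ hδ).Λ s where
  meromorphic := by
    intro s
    have he : AnalyticAt ℂ (fun s : ℂ ↦ -e (-s / 4)) s := by
      have : Differentiable ℂ (fun s : ℂ ↦ -e (-s / 4)) := by
        unfold e
        fun_prop
      exact this.analyticAt s
    refine he.meromorphicAt.mul ?_
    unfold WeakFEPair.Λ
    have h0 := ((hf.fePair hN (by omega) δ hδ).differentiable_Λ₀.analyticAt s).meromorphicAt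
    refine (h0.sub ?_).sub ?_
    · exact ((MeromorphicAt.const 1 s).div (MeromorphicAt.id s)).smul (MeromorphicAt.const _ s)
    · exact ((MeromorphicAt.const _ s).div ((MeromorphicAt.const _ s).sub
        (MeromorphicAt.id s))).smul (MeromorphicAt.const _ s)
  differentiableOn := by
    intro s hs
    simp only [mem_compl_iff, mem_insert_iff, mem_singleton_iff, not_or] at hs
    have he : Differentiable ℂ (fun s : ℂ ↦ -e (-s / 4)) := by
      unfold e
      fun_prop
    refine (he.differentiableAt.mul ?_).differentiableWithinAt
    exact (hf.fePair hN (by omega) δ hδ).differentiableAt_Λ (Or.inl hs.1)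
      (Or.inl (by simpa [fePair] using hs.2))
  summable s hs := hf.lseriesSummable_twistedCoeff hN hk y hs
  eq_series s hs := by
    have hk0 : 0 < k := by omega
    rw [← ((hf.fePair hN hk0 δ hδ).hasMellin (s := s) (by simpa [fePair] using hs)).2]
    have := hf.mellin_vertical hN hk y hs
    rw [hy] at this
    simp only [fePair]
    rw [this]
    ring

theorem isCompletedTwistedL (hf : IsFormOfLevel N k f) (hN : 0 < N) (hk : 2 ≤ k) (y : ℚ) :
    IsCompletedTwistedL N k f y (completedTwistedL N k f y) := by
  obtain ⟨δ, h0, h1⟩ := exists_SL_of_rat y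
  have hδ : δ 1 0 ≠ 0 := by
    rw [h1]
    exact_mod_cast y.den_ne_zero
  refine Classical.epsilon_spec ⟨_, hf.isCompletedTwistedL_fePair hN hk hδ ?_⟩
  rw [h0, h1, Rat.cast_def]
  simp

theorem completedTwistedL_eq_fePair (hf : IsFormOfLevel N k f) (hN : 0 < N) (hk : 2 ≤ k) {y : ℚ}
    {δ : SL(2, ℤ)} (hδ : δ 1 0 ≠ 0) (hy : (y : ℝ) = (δ 0 0 : ℝ) / δ 1 0) {s : ℂ}
    (hs0 : s ≠ 0) (hsk : s ≠ k) :
    completedTwistedL N k f y s = -e (-s / 4) * (hf.fePair hN (by omega) δ hδ).Λ s :=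
  (hf.isCompletedTwistedL hN hk y).eq_of_ne (hf.isCompletedTwistedL_fePair hN hk hδ hy) hs0 hsk

/-- Primitives of a rapidly decaying function have the same limit along all vertical lines. -/
theorem tendsto_vertical_sub (hf : IsFormOfLevel N k f) (hN : 0 < N) {H : ℂ → ℂ} {κ ξ : ℂ} {n : ℕ}
    (hH : ∀ z : ℂ, 0 < z.im →
      HasDerivAt H (κ * (f (ofComplex z) - valueAtInfty f) * (ξ - z) ^ n) z) (x₁ x₂ : ℝ) :
    Tendsto (fun t : ℝ ↦ H (x₁ + t * Complex.I) - H (x₂ + t * Complex.I)) atTop (𝓝 0) := by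
  obtain ⟨C, hC⟩ := (hf.sub_valueAtInfty_isBigO hN).bound
  rw [atImInfty, eventually_comap, eventually_atTop] at hC
  obtain ⟨A, hA⟩ := hC
  have hN' : (0 : ℝ) < N := by exact_mod_cast hN
  -- For `t ≥ K` one has `‖ξ - z‖ ≤ 2t` on the horizontal segment at height `t`, so the polynomial
  -- factor loses to the exponential decay of `f - a₀`.
  set K : ℝ := ‖ξ‖ + |x₁| + |x₂| with hK
  have hb : 0 < 2 * Real.pi / N := by have := Real.pi_pos; positivity
  have hlim : Tendsto (fun t : ℝ ↦ ‖κ‖ * C * 2 ^ n * |x₁ - x₂| *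
      (t ^ (n : ℝ) * Real.exp (-(2 * Real.pi / N) * t))) atTop (𝓝 0) := by
    simpa using (tendsto_rpow_mul_exp_neg_mul_atTop_nhds_zero n _ hb).const_mul
      (‖κ‖ * C * 2 ^ n * |x₁ - x₂|)
  refine squeeze_zero_norm' ?_ hlim
  filter_upwards [eventually_ge_atTop A, eventually_ge_atTop K, eventually_gt_atTop 0]
    with t htA htK ht
  have hderiv : ∀ u ∈ uIcc x₂ x₁, HasDerivWithinAt (fun u : ℝ ↦ H (u + t * Complex.I))
      (κ * (f (ofComplex (u + t * Complex.I)) - valueAtInfty f) * (ξ - (u + t * Complex.I)) ^ n)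
      (uIcc x₂ x₁) u := by
    intro u _
    have h1 : HasDerivAt (fun z : ℂ ↦ z + t * Complex.I) 1 (u : ℂ) :=
      (hasDerivAt_id _).add_const _
    have h2 := (hH (u + t * Complex.I) (by rwa [im_vertical])).comp (u : ℂ) h1
    rw [mul_one] at h2
    exact h2.comp_ofReal.hasDerivWithinAt
  have hbound : ∀ u ∈ uIcc x₂ x₁,
      ‖κ * (f (ofComplex (u + t * Complex.I)) - valueAtInfty f) * (ξ - (u + t * Complex.I)) ^ n‖
      ≤ ‖κ‖ * C * 2 ^ n * (t ^ (n : ℝ) * Real.exp (-(2 * Real.pi / N) * t)) := by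
    intro u hu
    have him : 0 < ((u : ℂ) + t * Complex.I).im := by rwa [im_vertical]
    have hτ : (ofComplex (u + t * Complex.I)).im = t := by
      rw [ofComplex_apply_of_im_pos him, ← coe_im]
      exact im_vertical u t
    have h1 := hA t htA _ hτ
    rw [hτ, Real.norm_of_nonneg (Real.exp_pos _).le] at h1
    have hu' : |u| ≤ |x₁| + |x₂| := by
      rcases mem_uIcc.mp hu with h | h <;>
        exact abs_le.mpr ⟨by linarith [neg_abs_le x₁, neg_abs_le x₂, abs_nonneg x₁, abs_nonneg x₂],
          by linarith [le_abs_self x₁, le_abs_self x₂, abs_nonneg x₁, abs_nonneg x₂]⟩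
    have h2 : ‖ξ - (u + t * Complex.I)‖ ≤ 2 * t := by
      calc ‖ξ - (u + t * Complex.I)‖ ≤ ‖ξ‖ + (‖(u : ℂ)‖ + ‖t * Complex.I‖) :=
            (norm_sub_le _ _).trans (by gcongr; exact norm_add_le _ _)
        _ = ‖ξ‖ + (|u| + t) := by simp [abs_of_pos ht]
        _ ≤ 2 * t := by linarith
    rw [norm_mul, norm_mul, norm_pow]
    calc _ ≤ ‖κ‖ * (C * Real.exp (-2 * Real.pi * t / N)) * (2 * t) ^ n := by
            gcongr
            exact mul_nonneg (norm_nonneg _) ((norm_nonneg _).trans h1)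
      _ = _ := by
        rw [mul_pow, Real.rpow_natCast, show -2 * Real.pi * t / N = -(2 * Real.pi / N) * t by ring]
        ring
  have := (convex_uIcc x₂ x₁).norm_image_sub_le_of_norm_hasDerivWithin_le hderiv hbound
    left_mem_uIcc right_mem_uIcc
  refine this.trans (le_of_eq ?_)
  rw [Real.norm_eq_abs]
  ring

end IsFormOfLevel

end Completion

/-! ### Limits of primitives with integrable derivative. -/

section Limits

open MeasureTheory

theorem tendsto_atTop_of_hasDerivAt_of_integrableOn {g g' : ℝ → ℂ}
    (hderiv : ∀ t : ℝ, 0 < t → HasDerivAt g (g' t) t) (hint : IntegrableOn g' (Ioi 1)) :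
    Tendsto g atTop (𝓝 (g 1 + ∫ t in Ioi 1, g' t)) := by
  have h1 := tendsto_limUnder_of_hasDerivAt_of_integrableOn_Ioi (a := 1)
    (fun t ht ↦ hderiv t (one_pos.trans ht)) hint
  have h2 := integral_Ioi_of_hasDerivAt_of_tendsto' (a := 1)
    (fun t ht ↦ hderiv t (one_pos.trans_le ht)) hint h1
  rw [h2]
  simpa using h1

theorem tendsto_nhdsGT_zero_of_hasDerivAt_of_integrableOn {g g' : ℝ → ℂ}
    (hderiv : ∀ t : ℝ, 0 < t → HasDerivAt g (g' t) t) (hint : IntegrableOn g' (Ioo 0 1)) :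
    Tendsto g (𝓝[>] 0) (𝓝 (g 1 - ∫ t in Ioo 0 1, g' t)) := by
  have hint' : IntegrableOn g' (uIcc 0 1) := by
    rw [uIcc_of_le zero_le_one]
    exact integrableOn_Icc_iff_integrableOn_Ioo (by simp) (by simp) |>.mpr hint
  have h1 := (intervalIntegral.continuousOn_primitive_interval_left hint') 0 left_mem_uIcc
  have h2 : Tendsto (fun t : ℝ ↦ g 1 - ∫ u in t..1, g' u) (𝓝[>] 0)
      (𝓝 (g 1 - ∫ t in Ioo 0 1, g' t)) := by
    refine tendsto_const_nhds.sub ?_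
    rw [← integral_Ioc_eq_integral_Ioo, ← intervalIntegral.integral_of_le zero_le_one]
    rw [uIcc_of_le zero_le_one] at h1
    refine h1.tendsto.mono_left ?_
    rw [nhdsWithin_Icc_eq_nhdsGE zero_lt_one]
    exact nhdsWithin_mono _ Ioi_subset_Ici_self
  refine h2.congr' ?_
  filter_upwards [Ioo_mem_nhdsGT (zero_lt_one (α := ℝ))] with t ht
  rw [intervalIntegral.integral_eq_sub_of_hasDerivAt]
  · ring
  · intro u hu
    rw [uIcc_of_le ht.2.le] at hu
    exact hderiv u (ht.1.trans_le hu.1)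
  · refine IntegrableOn.intervalIntegrable (hint'.mono_set ?_)
    rw [uIcc_of_le ht.2.le, uIcc_of_le zero_le_one]
    exact Icc_subset_Icc_left ht.1.le

end Limits

/-! ### Critical values as regularized periods. -/

section CriticalValues

open MeasureTheory Complex

theorem e_neg_div_four (m : ℕ) : e (-(m : ℂ) / 4) = (-Complex.I) ^ m := by
  rw [← exp_neg_pi_div_two_mul_I, ← Complex.exp_nat_mul, e]
  congr 1
  ring

namespace IsFormOfLevel

variable {N k : ℕ} {f : ℍ → ℂ}

/-- The critical values of the completed twisted `L`-function are regularized period integrals. -/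
theorem exists_tendsto_completedTwistedL (hf : IsFormOfLevel N k f) (hN : 0 < N) {j l : ℕ}
    (hjl : j + 1 + l = k) (hl : 0 < l) {y : ℚ} {δ : SL(2, ℤ)} (hδ : δ 1 0 ≠ 0)
    (hy : (y : ℝ) = (δ 0 0 : ℝ) / δ 1 0) {G : ℂ → ℂ}
    (hG : ∀ z : ℂ, 0 < z.im → HasDerivAt G (f (ofComplex z) * (y - z) ^ j) z) :
    ∃ A B : ℂ,
      Tendsto (fun t : ℝ ↦ G ((y : ℝ) + t * Complex.I) + valueAtInfty f * (-(t * Complex.I)) ^ (j + 1) / (j + 1))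
        atTop (𝓝 A) ∧
      Tendsto (fun t : ℝ ↦ G ((y : ℝ) + t * Complex.I) -
        valueAtInfty (f ∣[(k : ℤ)] δ) / (δ 1 0 : ℂ) ^ k / (l * (-(t * Complex.I)) ^ l)) (𝓝[>] 0) (𝓝 B) ∧
      completedTwistedL N k f y (j + 1) = A - B := by
  have hk : 2 ≤ k := by omega
  have hk0 : 0 < k := by omega
  set P := hf.fePair hN hk0 δ hδ with hP
  set v := valueAtInfty f with hv
  set w := valueAtInfty (f ∣[(k : ℤ)] δ) with hw
  set F : ℝ → ℂ := fun t ↦ f (ofComplex ((y : ℝ) + t * Complex.I)) with hF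
  -- On `z = y + it`, `(y - z)^j dz = κ t^j dt`; the same `κ` is the prefactor `-e(-(j+1)/4)` of
  -- `L̂_f`.
  set κ : ℂ := Complex.I * (-Complex.I) ^ j with hκ
  set J : ℝ → ℂ := fun t ↦ (t : ℂ) ^ (((j : ℂ) + 1) - 1) • P.f_modif t with hJ
  have hPf : ∀ t, P.f t = F t := by
    intro t
    simp only [hP, fePair, hF, hy, one_mul]
  have hp : (δ 1 0 : ℂ) ≠ 0 := by exact_mod_cast hδ
  have hl0 : (l : ℂ) ≠ 0 := by exact_mod_cast hl.ne'
  have hj0 : (j : ℂ) + 1 ≠ 0 := by exact_mod_cast j.succ_ne_zero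
  have hJint : IntegrableOn J (Ioi 0) :=
    (P.isStrongFEPair_toStrongFEPair.hasMellin ((j : ℂ) + 1)).1
  -- `f_modif` subtracts the constant term beyond `1` and the leading singularity at the cusp below
  -- `1`. Up to the factor `κ t^j`, these are the derivatives of the corrections in `Φ` and `Ψ`.
  have hJ1 : ∀ t ∈ Ioi (1 : ℝ), κ * J t = κ * ((t : ℂ) ^ j * (F t - v)) := by
    intro t ht
    simp only [hJ, WeakFEPair.f_modif, Pi.add_apply, indicator_of_mem ht,
      indicator_of_notMem (notMem_Ioo_of_ge (mem_Ioi.mp ht).le), hPf, add_sub_cancel_right,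
      Complex.cpow_natCast, smul_eq_mul, add_zero]
    rfl
  have hJ0 : ∀ t ∈ Ioo (0 : ℝ) 1, κ * J t
      = κ * (t : ℂ) ^ j * F t - w / (δ 1 0 : ℂ) ^ k * Complex.I / (-(t * Complex.I)) ^ (l + 1) := by
    intro t ht
    have ht0 : (t : ℂ) ≠ 0 := by exact_mod_cast ht.1.ne'
    simp only [hJ, WeakFEPair.f_modif, Pi.add_apply, indicator_of_mem ht,
      indicator_of_notMem (notMem_Ioi.mpr ht.2.le), hPf, add_sub_cancel_right,
      Complex.cpow_natCast, smul_eq_mul, zero_add]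
    have h1 : P.ε * ((t ^ (-P.k) : ℝ) : ℂ) * P.g₀ = (Complex.I / δ 1 0) ^ k * ((t : ℂ) ^ k)⁻¹ * w := by
      have : t ^ (-P.k) = (t ^ k)⁻¹ := by
        rw [Real.rpow_neg ht.1.le]
        simp [hP, fePair]
      rw [this]
      simp [hP, fePair, hw]
    rw [h1, mul_sub, mul_sub, ← mul_assoc]
    congr 1
    rw [← hjl, hκ]
    have hI : (-Complex.I) ^ (j + 1 + l) * Complex.I ^ (j + 1 + l) = 1 := by
      rw [← mul_pow]
      simp
    rw [div_pow, ← mul_neg, mul_pow]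
    field_simp
    ring_nf at hI ⊢
    linear_combination ((t : ℂ) * t ^ j * t ^ l * w) * hI
  have hline : ∀ z : ℂ, HasDerivAt (fun z : ℂ ↦ ((y : ℝ) : ℂ) + z * Complex.I) Complex.I z := fun z ↦ by
    simpa using ((hasDerivAt_id z).mul_const Complex.I).const_add ((y : ℝ) : ℂ)
  have hneg : ∀ z : ℂ, HasDerivAt (fun z : ℂ ↦ -(z * Complex.I)) (-Complex.I) z := fun z ↦ by
    simpa using ((hasDerivAt_id z).mul_const Complex.I).fun_neg
  have hGline : ∀ t : ℝ, 0 < t →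
      HasDerivAt (fun z : ℂ ↦ G ((y : ℝ) + z * Complex.I)) (κ * (t : ℂ) ^ j * F t) t := by
    intro t ht
    convert! (hG ((y : ℝ) + t * Complex.I) (by rwa [im_vertical])).comp (t : ℂ) (hline t) using 1
    have : (y : ℂ) - (((y : ℝ) : ℂ) + t * Complex.I) = (-Complex.I) * t := by
      rw [Complex.ofReal_ratCast]
      ring
    rw [this, mul_pow, hκ]
    simp only [hF]
    ring
  set Φ : ℝ → ℂ := fun t ↦ G ((y : ℝ) + t * Complex.I) + v * (-(t * Complex.I)) ^ (j + 1) / (j + 1) with hΦ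
  set Ψ : ℝ → ℂ := fun t ↦ G ((y : ℝ) + t * Complex.I) - w / (δ 1 0 : ℂ) ^ k / (l * (-(t * Complex.I)) ^ l) with hΨ
  have hΦ' : ∀ t : ℝ, 0 < t → HasDerivAt Φ (κ * ((t : ℂ) ^ j * (F t - v))) t := by
    intro t ht
    have h1 : HasDerivAt (fun z : ℂ ↦ v * (-(z * Complex.I)) ^ (j + 1) / (j + 1))
        (v * (((j + 1 : ℕ) : ℂ) * (-(t * Complex.I)) ^ j * (-Complex.I)) / (j + 1)) t :=
      (((hneg t).fun_pow (j + 1)).const_mul v).div_const _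
    have h2 := ((hGline t ht).add h1).comp_ofReal
    convert! h2 using 1
    rw [← mul_neg, mul_pow, hκ]
    push_cast
    field_simp
    ring
  have hΨ' : ∀ t : ℝ, 0 < t → HasDerivAt Ψ (κ * (t : ℂ) ^ j * F t
      - w / (δ 1 0 : ℂ) ^ k * Complex.I / (-(t * Complex.I)) ^ (l + 1)) t := by
    intro t ht
    have ht0 : (-((t : ℂ) * Complex.I)) ≠ 0 := by
      have : (t : ℂ) ≠ 0 := by exact_mod_cast ht.ne'
      simp [this]
    have h1 : HasDerivAt (fun z : ℂ ↦ w / (δ 1 0 : ℂ) ^ k / (l * (-(z * Complex.I)) ^ l))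
        (w / (δ 1 0 : ℂ) ^ k * Complex.I / (-(t * Complex.I)) ^ (l + 1)) t := by
      have h0 := (((hneg t).fun_pow l).const_mul (l : ℂ)).inv (mul_ne_zero hl0 (pow_ne_zero l ht0))
      convert! h0.const_mul (w / (δ 1 0 : ℂ) ^ k) using 1
      obtain ⟨l, rfl⟩ := Nat.exists_eq_succ_of_ne_zero hl.ne'
      rw [Nat.succ_eq_add_one, Nat.add_sub_cancel]
      generalize -((t : ℂ) * Complex.I) = q at ht0
      field_simp
      ring
    exact ((hGline t ht).sub h1).comp_ofReal
  have hint1 : IntegrableOn (fun t : ℝ ↦ κ * ((t : ℂ) ^ j * (F t - v))) (Ioi 1) :=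
    IntegrableOn.congr_fun ((hJint.mono_set (Ioi_subset_Ioi zero_le_one)).const_mul κ) hJ1
      measurableSet_Ioi
  have hint0 : IntegrableOn (fun t : ℝ ↦ κ * (t : ℂ) ^ j * F t
      - w / (δ 1 0 : ℂ) ^ k * Complex.I / (-(t * Complex.I)) ^ (l + 1)) (Ioo 0 1) :=
    IntegrableOn.congr_fun ((hJint.mono_set Ioo_subset_Ioi_self).const_mul κ) hJ0 measurableSet_Ioo
  refine ⟨_, _, tendsto_atTop_of_hasDerivAt_of_integrableOn hΦ' hint1,
    tendsto_nhdsGT_zero_of_hasDerivAt_of_integrableOn hΨ' hint0, ?_⟩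
  have hsplit : κ * P.Λ₀ ((j : ℂ) + 1) = (∫ t in Ioo (0 : ℝ) 1, κ * J t) +
      ∫ t in Ioi (1 : ℝ), κ * J t := by
    rw [← integral_Ioc_eq_integral_Ioo, ← setIntegral_union, Ioc_union_Ioi_eq_Ioi zero_le_one,
      integral_const_mul]
    · rfl
    · exact Set.disjoint_left.mpr fun t ht ht' ↦ not_lt.mpr ht.2 ht'
    · exact measurableSet_Ioi
    · exact (hJint.mono_set Ioc_subset_Ioi_self).const_mul κ
    · exact (hJint.mono_set (Ioi_subset_Ioi zero_le_one)).const_mul κ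
  rw [setIntegral_congr_fun measurableSet_Ioo hJ0, setIntegral_congr_fun measurableSet_Ioi hJ1]
    at hsplit
  have hkj : (k : ℂ) = j + 1 + l := by exact_mod_cast hjl.symm
  rw [hf.completedTwistedL_eq_fePair hN hk hδ hy hj0 (by rw [hkj]; simpa using hl0), ← hP]
  have hee : -e (-((j : ℂ) + 1) / 4) = κ := by
    have := e_neg_div_four (j + 1)
    push_cast at this
    rw [this, hκ]
    ring
  -- After multiplication by `κ` the two pole terms are the corrections in `Φ` and `-Ψ` at `t = 1`,
  -- and the values of `G` there cancel in `A - B`.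
  have hΛ : P.Λ ((j : ℂ) + 1) = P.Λ₀ ((j : ℂ) + 1) - 1 / ((j : ℂ) + 1) * v
      - (Complex.I / δ 1 0) ^ k / l * w := by
    have hε : P.ε = (Complex.I / δ 1 0) ^ k := rfl
    have hPk : (P.k : ℂ) = k := by simp [hP, fePair]
    have hd : (k : ℂ) - (j + 1) = l := by rw [hkj]; ring
    rw [WeakFEPair.Λ, hε, hPk, hd]
    rfl
  rw [hee, hΛ, mul_sub, mul_sub, hsplit]
  simp only [hΦ, hΨ, ofReal_one, one_mul]
  have hb : κ * ((Complex.I / δ 1 0) ^ k / l * w)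
      = -(w / (δ 1 0 : ℂ) ^ k / (l * (-Complex.I) ^ l)) := by
    have hI : (-Complex.I) ^ (j + l) * Complex.I ^ (j + l) = 1 := by
      rw [← mul_pow]
      simp
    have hIl : (-Complex.I) ^ l ≠ 0 := pow_ne_zero _ (by simp)
    have hkj' : k = (j + l) + 1 := by omega
    rw [hκ, div_pow, eq_neg_iff_add_eq_zero]
    nth_rewrite 1 [hkj']
    field_simp
    rw [pow_succ]
    linear_combination (Complex.I ^ 2 * w) * hI + w * Complex.I_sq
  have hκ' : (-Complex.I) ^ (j + 1) = -κ := by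
    rw [hκ, pow_succ]
    ring
  rw [hb, hκ']
  ring

end IsFormOfLevel

end CriticalValues

/-! ### Binomial sums of the regularizing terms. -/

section Binomial

/-- This is `(X + u)^n` integrated from `0`; it sums the divergent terms at `i∞`. -/
theorem sum_choose_mul_pow_succ_div (n : ℕ) (X u : ℂ) :
    ∑ j ∈ Finset.range (n + 1), (n.choose j : ℂ) * X ^ (n - j) * (u ^ (j + 1) / (j + 1))
      = ((X + u) ^ (n + 1) - X ^ (n + 1)) / (n + 1) := by
  have hn : (n : ℂ) + 1 ≠ 0 := by exact_mod_cast n.succ_ne_zero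
  rw [eq_div_iff hn, add_comm X u, add_pow, Finset.sum_range_succ' _ (n + 1),
    Finset.sum_mul]
  simp only [pow_zero, one_mul, Nat.sub_zero, Nat.choose_zero_right, Nat.cast_one, mul_one,
    add_sub_cancel_right]
  refine Finset.sum_congr rfl fun j _ ↦ ?_
  have hj : (j : ℂ) + 1 ≠ 0 := by exact_mod_cast j.succ_ne_zero
  have h : ((n : ℂ) + 1) * n.choose j = (n + 1).choose (j + 1) * (j + 1) := by
    exact_mod_cast Nat.add_one_mul_choose_eq n j
  rw [Nat.add_sub_add_right]
  field_simp
  linear_combination (X ^ (n - j) * u * u ^ j) * h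

/-- After multiplication by `(n + 1) X` the sum is the expansion of `(1 + X/v)^(n+1)` without its
term `1`; it sums the divergent terms at the cusp `-d/c`. -/
theorem sum_choose_mul_inv_pow (n : ℕ) {X v : ℂ} (hX : X ≠ 0) (hv : v ≠ 0) :
    ∑ j ∈ Finset.range (n + 1), (n.choose j : ℂ) * X ^ (n - j) *
        (((n + 1 - j : ℕ) : ℂ) * v ^ (n + 1 - j))⁻¹
      = ((X + v) ^ (n + 1) - v ^ (n + 1)) / ((n + 1) * X * v ^ (n + 1)) := by
  have hn : (n : ℂ) + 1 ≠ 0 := by exact_mod_cast n.succ_ne_zero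
  rw [eq_div_iff (by simp [hn, hX, hv]), add_comm X v, add_pow,
    Finset.sum_range_succ _ (n + 1), Finset.sum_mul]
  simp only [Nat.sub_self, pow_zero, Nat.choose_self, Nat.cast_one, mul_one, add_sub_cancel_right]
  refine Finset.sum_congr rfl fun j hj ↦ ?_
  have hjn : j ≤ n := Nat.lt_succ_iff.mp (Finset.mem_range.mp hj)
  obtain ⟨m, rfl⟩ := Nat.exists_eq_add_of_le hjn
  have h1 : j + m + 1 - j = m + 1 := by omega
  have h2 : j + m - j = m := by omega
  have h : ((j + m).choose j : ℂ) * ((j + m : ℕ) + 1) = (j + m + 1).choose j * ((m + 1 : ℕ) : ℂ) := by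
    have := Nat.choose_mul_succ_eq (j + m) j
    rw [h1] at this
    exact_mod_cast this
  have hm : ((m + 1 : ℕ) : ℂ) ≠ 0 := by exact_mod_cast m.succ_ne_zero
  rw [h1, h2]
  rw [← div_eq_mul_inv, div_mul_eq_mul_div, div_eq_iff (mul_ne_zero hm (pow_ne_zero _ hv))]
  rw [show v ^ (j + m + 1) = v ^ j * v ^ (m + 1) by ring]
  linear_combination (X ^ m * X * v ^ j * v ^ (m + 1)) * h

end Binomial

/-! ### Transport of primitives by `γ⁻¹`. -/

section Transport

theorem exists_primitive {h : ℂ → ℂ} (hh : DifferentiableOn ℂ h {z | 0 < z.im}) :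
    ∃ G : ℂ → ℂ, ∀ z : ℂ, 0 < z.im → HasDerivAt G (h z) z := by
  have hopen : IsOpen {z : ℂ | 0 < z.im} := isOpen_lt continuous_const Complex.continuous_im
  obtain ⟨G, hG⟩ := (convex_halfSpace_im_gt 0).exists_forall_hasDerivWithinAt hh
  exact ⟨G, fun z hz ↦ (hG z hz).hasDerivAt (hopen.mem_nhds hz)⟩

theorem coe_inv_apply (γ : SL(2, ℤ)) :
    (γ⁻¹) 0 0 = γ 1 1 ∧ (γ⁻¹) 0 1 = -γ 0 1 ∧ (γ⁻¹) 1 0 = -γ 1 0 ∧ (γ⁻¹) 1 1 = γ 0 0 := by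
  rw [Matrix.SpecialLinearGroup.coe_inv, Matrix.adjugate_fin_two]
  simp

theorem denom_inv_ne_zero (γ : SL(2, ℤ)) {u : ℂ} (hu : 0 < u.im) :
    (γ 0 0 : ℂ) - γ 1 0 * u ≠ 0 := by
  obtain ⟨-, -, h2, h3⟩ := coe_inv_apply γ
  have := denom_ne_zero_of_im_pos γ⁻¹ hu
  rw [h2, h3] at this
  intro h
  apply this
  push_cast
  linear_combination h

/-- Since `x = γ⁻¹ξ`, this is the rule for differences under a Möbius map; its `n`-th power supplies
the factors left over from weight `n + 2` and the derivative. -/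
theorem sub_moebius_inv (γ : SL(2, ℤ)) {x ξ u : ℂ}
    (hξ : ξ * (γ 1 0 * x + γ 1 1) = γ 0 0 * x + γ 0 1) (hu : 0 < u.im) :
    x - moebius γ⁻¹ u = (γ 1 0 * x + γ 1 1) * (ξ - u) / (γ 0 0 - γ 1 0 * u) := by
  obtain ⟨h0, h1, h2, h3⟩ := coe_inv_apply γ
  have hne := denom_inv_ne_zero γ hu
  have h : ((-γ 1 0 : ℤ) : ℂ) * u + γ 0 0 = γ 0 0 - γ 1 0 * u := by
    push_cast
    ring
  rw [moebius, h0, h1, h2, h3, h, eq_div_iff hne, sub_mul, div_mul_cancel₀ _ hne]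
  push_cast
  linear_combination -hξ

/-- Transport of primitives by an element of the group under which `f` is modular. -/
theorem hasDerivAt_comp_moebius_inv {n : ℕ} {f : ℍ → ℂ} {γ : SL(2, ℤ)}
    (hγ : f ∣[((n + 2 : ℕ) : ℤ)] γ = f) {x ξ : ℂ}
    (hξ : ξ * (γ 1 0 * x + γ 1 1) = γ 0 0 * x + γ 0 1) {G : ℂ → ℂ}
    (hG : ∀ z : ℂ, 0 < z.im → HasDerivAt G (f (ofComplex z) * (x - z) ^ n) z) {u : ℂ}
    (hu : 0 < u.im) :
    HasDerivAt (fun u ↦ G (moebius γ⁻¹ u))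
      ((γ 1 0 * x + γ 1 1) ^ n * (f (ofComplex u) * (ξ - u) ^ n)) u := by
  obtain ⟨-, -, h2, h3⟩ := coe_inv_apply γ
  have hγ' : f ∣[((n + 2 : ℕ) : ℤ)] γ⁻¹ = f := by
    nth_rewrite 1 [← hγ]
    rw [← SlashAction.slash_mul, mul_inv_cancel, SlashAction.slash_one]
  have hne := denom_inv_ne_zero γ hu
  convert! (hG _ (im_moebius_pos γ⁻¹ hu)).comp u
    (hasDerivAt_moebius γ⁻¹ (denom_ne_zero_of_im_pos γ⁻¹ hu)) using 1
  rw [comp_ofComplex_moebius (n + 2) f γ⁻¹ hu, hγ', sub_moebius_inv γ hξ hu, h2, h3, div_pow,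
    mul_pow]
  have : ((-γ 1 0 : ℤ) : ℂ) * u + γ 0 0 = γ 0 0 - γ 1 0 * u := by
    push_cast
    ring
  rw [this]
  field_simp
  ring

theorem tendsto_vertical_scale {H : ℂ → ℂ} {x₁ x₂ : ℝ} {c₁ : ℝ} (hc₁ : 0 < c₁) {A : ℂ}
    (hsub : Tendsto (fun t : ℝ ↦ H (x₁ + t * Complex.I) - H (x₂ + t * Complex.I)) atTop (𝓝 0))
    (h₁ : Tendsto (fun t : ℝ ↦ H (x₁ + (t / c₁ : ℝ) * Complex.I)) atTop (𝓝 A)) :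
    Tendsto (fun t : ℝ ↦ H (x₂ + t * Complex.I)) atTop (𝓝 A) := by
  have h := h₁.comp (tendsto_id.const_mul_atTop hc₁)
  have h' : Tendsto (fun t : ℝ ↦ H (x₁ + t * Complex.I)) atTop (𝓝 A) := by
    refine h.congr fun t ↦ ?_
    rw [Function.comp_apply, id_eq, mul_div_cancel_left₀ _ hc₁.ne']
  simpa using h'.sub hsub

end Transport

/-! ### Comparison at the cusps `x` and `γx`. -/

section Reciprocity

variable {N n : ℕ} {f : ℍ → ℂ}

/-- Approach to a cusp along a vertical line, in the coordinate of `i∞`. -/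
theorem tendsto_moebius_vertical {Φ : ℝ → ℂ → ℂ} (δ : SL(2, ℤ)) (hδ : δ 1 0 ≠ 0) {x : ℝ}
    (hx : x = (δ 0 0 : ℝ) / δ 1 0) {B : ℂ}
    (h : Tendsto (fun t : ℝ ↦ Φ t (x + t * Complex.I)) (𝓝[>] 0) (𝓝 B)) :
    Tendsto (fun t : ℝ ↦ Φ t⁻¹ (moebius δ ((-(δ 1 1 : ℝ) / δ 1 0 : ℝ)
      + (t / (δ 1 0 : ℝ) ^ 2 : ℝ) * Complex.I))) atTop (𝓝 B) := by
  refine (h.comp tendsto_inv_atTop_nhdsGT_zero).congr' ?_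
  filter_upwards [eventually_gt_atTop 0] with t ht
  rw [moebius_vertical δ hδ ht.ne', ← hx, one_div, Function.comp_apply]

theorem denom_vertical (δ : SL(2, ℤ)) (hδ : δ 1 0 ≠ 0) (t : ℝ) :
    (δ 1 0 : ℂ) * ((-(δ 1 1 : ℝ) / δ 1 0 : ℝ) + (t / (δ 1 0 : ℝ) ^ 2 : ℝ) * Complex.I) + δ 1 1
      = t * Complex.I / δ 1 0 := by
  have h : (δ 1 0 : ℂ) ≠ 0 := by exact_mod_cast hδ
  push_cast
  field_simp
  ring

theorem sub_moebius (δ : SL(2, ℤ)) (hδ : δ 1 0 ≠ 0) {z : ℂ} (hz : 0 < z.im) :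
    (δ 0 0 : ℂ) / δ 1 0 - moebius δ z = (δ 1 0 * (δ 1 0 * z + δ 1 1) : ℂ)⁻¹ := by
  have h : (δ 1 0 : ℂ) ≠ 0 := by exact_mod_cast hδ
  have h' := denom_ne_zero_of_im_pos δ hz
  rw [moebius, div_sub_div _ _ h h', inv_eq_one_div]
  congr 1
  linear_combination det_complex δ

namespace IsFormOfLevel

/-- Comparison of the regularized values of a primitive at a cusp and at its translate. -/
theorem cusp_value_transport (hf : IsFormOfLevel N (n + 2) f) (hN : 0 < N) {γ δ : SL(2, ℤ)}
    (hδ : δ 1 0 ≠ 0) (hγδ : (γ * δ) 1 0 ≠ 0) {x ξ : ℝ} (hx : x = (δ 0 0 : ℝ) / δ 1 0)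
    (hξ : ξ = ((γ * δ) 0 0 : ℝ) / (γ * δ) 1 0) {G : ℂ → ℂ}
    (hG : ∀ z : ℂ, 0 < z.im → HasDerivAt G (f (ofComplex z) * (x - z) ^ n) z) {σ Bx Bξ : ℂ}
    (hσ : σ = γ 1 0 * x + γ 1 1)
    (hBx : Tendsto (fun t : ℝ ↦ G (x + t * Complex.I)
      - valueAtInfty (f ∣[((n + 2 : ℕ) : ℤ)] δ) / (δ 1 0 : ℂ) ^ (n + 2)
        / ((1 : ℕ) * (-(t * Complex.I)) ^ 1)) (𝓝[>] 0) (𝓝 Bx))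
    (hBξ : Tendsto (fun t : ℝ ↦ (σ ^ n)⁻¹ * G (moebius γ⁻¹ (ξ + t * Complex.I))
      - valueAtInfty (f ∣[((n + 2 : ℕ) : ℤ)] δ) / ((γ * δ) 1 0 : ℂ) ^ (n + 2)
        / ((1 : ℕ) * (-(t * Complex.I)) ^ 1)) (𝓝[>] 0) (𝓝 Bξ)) :
    σ ^ n * Bξ = Bx + valueAtInfty (f ∣[((n + 2 : ℕ) : ℤ)] δ) / (δ 1 0 : ℂ) ^ (n + 2)
      * (γ 1 0 / σ) := by
  set a := valueAtInfty (f ∣[((n + 2 : ℕ) : ℤ)] δ) with ha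
  have hp : (δ 1 0 : ℂ) ≠ 0 := by exact_mod_cast hδ
  have hp' : ((γ * δ) 1 0 : ℂ) ≠ 0 := by exact_mod_cast hγδ
  have hx' : (x : ℂ) = (δ 0 0 : ℂ) / δ 1 0 := by rw [hx]; push_cast; rfl
  have hpσ : ((γ * δ) 1 0 : ℂ) = δ 1 0 * σ := by
    rw [hσ, hx', Matrix.SpecialLinearGroup.coe_mul, Matrix.mul_apply, Fin.sum_univ_two]
    push_cast
    field_simp
  have hD' : ((γ * δ) 1 1 : ℂ) = γ 1 0 * δ 0 1 + γ 1 1 * δ 1 1 := by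
    rw [Matrix.SpecialLinearGroup.coe_mul, Matrix.mul_apply, Fin.sum_univ_two]
    push_cast
    rfl
  have hσ0 : σ ≠ 0 := by
    rintro rfl
    exact hp' (by rw [hpσ, mul_zero])
  -- In the coordinate of `δ` the factor `(x - δz)^n` cancels the automorphy factor, so the
  -- derivative of `G ∘ δ` is a constant times `f ∣ δ`. A linear term then suffices to make it
  -- decay.
  set H : ℂ → ℂ := fun z ↦ G (moebius δ z) - a * (δ 1 0 * z + δ 1 1) / (δ 1 0 : ℂ) ^ (n + 1) with hH
  have hH' : ∀ z : ℂ, 0 < z.im → HasDerivAt H (((δ 1 0 : ℂ) ^ n)⁻¹ *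
      ((f ∣[((n + 2 : ℕ) : ℤ)] δ) (ofComplex z) - a) * (x - z) ^ 0) z := by
    intro z hz
    have hd := denom_ne_zero_of_im_pos δ hz
    have h1 := (hG _ (im_moebius_pos δ hz)).comp z (hasDerivAt_moebius δ hd)
    have h2 : HasDerivAt (fun z : ℂ ↦ a * (δ 1 0 * z + δ 1 1) / (δ 1 0 : ℂ) ^ (n + 1))
        (a * (δ 1 0 * 1) / (δ 1 0 : ℂ) ^ (n + 1)) z :=
      ((((hasDerivAt_id z).const_mul _).add_const _).const_mul a).div_const _
    convert! h1.sub h2 using 1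
    rw [comp_ofComplex_moebius (n + 2) f δ hz, hx', sub_moebius δ hδ hz, inv_pow,
      mul_pow]
    generalize (δ 1 0 : ℂ) * z + δ 1 1 = w at hd
    field_simp
    ring
  -- Vertical approach to `x` and to `ξ` becomes, via `δ` and `γ * δ`, ascent along two vertical
  -- lines, on which `H` has the same limit.
  have hsub := (hf.slash δ).tendsto_vertical_sub hN hH' (-(δ 1 1 : ℝ) / δ 1 0)
    (-((γ * δ) 1 1 : ℝ) / (γ * δ) 1 0)
  have hp2 : (0 : ℝ) < (δ 1 0 : ℝ) ^ 2 := by positivity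
  have hp2' : (0 : ℝ) < ((γ * δ) 1 0 : ℝ) ^ 2 := by positivity
  have h1 : Tendsto (fun t : ℝ ↦ H ((-(δ 1 1 : ℝ) / δ 1 0 : ℝ)
      + (t / (δ 1 0 : ℝ) ^ 2 : ℝ) * Complex.I)) atTop (𝓝 Bx) := by
    refine (tendsto_moebius_vertical (Φ := fun t z ↦ G z - a / (δ 1 0 : ℂ) ^ (n + 2)
        / ((1 : ℕ) * (-(t * Complex.I)) ^ 1)) δ hδ hx hBx).congr' ?_
    filter_upwards [eventually_gt_atTop 0] with t ht
    have ht' : (t : ℂ) ≠ 0 := by exact_mod_cast ht.ne'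
    simp only [hH]
    rw [denom_vertical δ hδ]
    push_cast
    field_simp
    linear_combination ((δ 1 0 : ℂ) ^ (n + 2) * a * t) * Complex.I_sq
  have h2 : Tendsto (fun t : ℝ ↦ H ((-((γ * δ) 1 1 : ℝ) / (γ * δ) 1 0 : ℝ)
      + (t / ((γ * δ) 1 0 : ℝ) ^ 2 : ℝ) * Complex.I)) atTop
      (𝓝 (σ ^ n * Bξ - a / (δ 1 0 : ℂ) ^ (n + 2) * (γ 1 0 / σ))) := by
    refine (((tendsto_moebius_vertical (Φ := fun t z ↦ (σ ^ n)⁻¹ * G (moebius γ⁻¹ z)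
      - a / ((γ * δ) 1 0 : ℂ) ^ (n + 2) / ((1 : ℕ) * (-(t * Complex.I)) ^ 1)) (γ * δ) hγδ hξ
      hBξ).const_mul (σ ^ n)).sub_const _).congr' ?_
    filter_upwards [eventually_gt_atTop 0] with t ht
    have ht' : (t : ℂ) ≠ 0 := by exact_mod_cast ht.ne'
    have him : 0 < (((-((γ * δ) 1 1 : ℝ) / (γ * δ) 1 0 : ℝ) : ℂ)
      + (t / ((γ * δ) 1 0 : ℝ) ^ 2 : ℝ) * Complex.I).im := by
      rw [im_vertical]
      positivity
    have hden := denom_vertical (γ * δ) hγδ t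
    simp only [hH]
    rw [← moebius_mul γ⁻¹ (γ * δ) him, inv_mul_cancel_left]
    generalize (((-((γ * δ) 1 1 : ℝ) / (γ * δ) 1 0 : ℝ) : ℂ)
      + (t / ((γ * δ) 1 0 : ℝ) ^ 2 : ℝ) * Complex.I) = z at hden ⊢
    -- On the second line the linear term of `H` has a constant part `γ₁₀/(δ₁₀σ)`; it is the source
    -- of the `a_0^{(x)}` correction.
    have hrel : (δ 1 0 : ℂ) * z + δ 1 1 = t * Complex.I / (δ 1 0 * σ ^ 2) + γ 1 0 / (δ 1 0 * σ) := by
      rw [hD', hpσ] at hden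
      have hσ' : σ * δ 1 0 = γ 1 0 * δ 0 0 + γ 1 1 * δ 1 0 := by
        rw [hσ, hx']
        field_simp
      field_simp at hden ⊢
      linear_combination hden + σ * δ 1 1 * hσ' + σ * γ 1 0 * det_complex δ
    rw [hrel, hpσ]
    push_cast
    field_simp
    linear_combination ((δ 1 0 : ℂ) ^ (2 * n + 4) * σ ^ (n + 2) * a * t) * Complex.I_sq
  have h3 := tendsto_nhds_unique (tendsto_vertical_scale hp2 hsub h1)
    (tendsto_vertical_scale hp2' (by simp) h2)
  rw [h3]
  ring

end IsFormOfLevel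

end Reciprocity

/-! ### Regularized values at `i∞` and at `γ⁻¹∞`. -/

section Period

variable {N n : ℕ} {f : ℍ → ℂ}

theorem hasDerivAt_sum_choose {n : ℕ} {F : ℂ → ℂ} {G : ℕ → ℂ → ℂ} {y X z : ℂ}
    (hG : ∀ j, HasDerivAt (G j) (F z * (y - z) ^ j) z) :
    HasDerivAt (fun z ↦ ∑ j ∈ Finset.range (n + 1), (n.choose j : ℂ) * X ^ (n - j) * G j z)
      (F z * (y + X - z) ^ n) z := by
  convert! HasDerivAt.fun_sum fun j (_ : j ∈ Finset.range (n + 1)) ↦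
    (hG j).const_mul ((n.choose j : ℂ) * X ^ (n - j)) using 1
  rw [show y + X - z = (y - z) + X by ring, add_pow, Finset.mul_sum]
  exact Finset.sum_congr rfl fun j _ ↦ by ring

theorem hasDerivAt_sub_pow_div (n : ℕ) (ξ z : ℂ) :
    HasDerivAt (fun z ↦ (ξ - z) ^ (n + 1) / (n + 1)) (-(ξ - z) ^ n) z := by
  have hn : (n : ℂ) + 1 ≠ 0 := by exact_mod_cast n.succ_ne_zero
  convert! (((hasDerivAt_id z).const_sub ξ).fun_pow (n + 1)).div_const ((n : ℂ) + 1) using 1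
  rw [Nat.add_sub_cancel]
  push_cast
  simp only [id_eq]
  field_simp

namespace IsFormOfLevel

/-- The regularized value at `i∞` of a primitive of `f (x - z)^n`, expanded at another point. -/
theorem value_atInfty_eq_sum (hf : IsFormOfLevel N (n + 2) f) (hN : 0 < N) {x y : ℝ} {X : ℂ}
    (hX : (y : ℂ) + X = x) {G : ℕ → ℂ → ℂ}
    (hG : ∀ j z, 0 < z.im → HasDerivAt (G j) (f (ofComplex z) * (y - z) ^ j) z) {A : ℕ → ℂ}
    (hA : ∀ j < n + 1, Tendsto (fun t : ℝ ↦ G j (y + t * Complex.I)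
      + valueAtInfty f * (-(t * Complex.I)) ^ (j + 1) / (j + 1)) atTop (𝓝 (A j))) :
    Tendsto (fun t : ℝ ↦ (∑ j ∈ Finset.range (n + 1), (n.choose j : ℂ) * X ^ (n - j) *
        G j (x + t * Complex.I)) + valueAtInfty f * (-(t * Complex.I)) ^ (n + 1) / (n + 1)) atTop
      (𝓝 (∑ j ∈ Finset.range (n + 1), (n.choose j : ℂ) * X ^ (n - j) * A j
        + valueAtInfty f * X ^ (n + 1) / (n + 1))) := by
  set a := valueAtInfty f with ha
  set H : ℂ → ℂ := fun z ↦ (∑ j ∈ Finset.range (n + 1), (n.choose j : ℂ) * X ^ (n - j) * G j z)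
    + a * ((x - z) ^ (n + 1) / (n + 1)) with hH
  have hH' : ∀ z : ℂ, 0 < z.im → HasDerivAt H (1 * (f (ofComplex z) - a) * (x - z) ^ n) z := by
    intro z hz
    convert! (hasDerivAt_sum_choose (n := n) (X := X) (F := fun z ↦ f (ofComplex z))
      fun j ↦ hG j z hz).add ((hasDerivAt_sub_pow_div n x z).const_mul a) using 1
    rw [hX]
    ring
  -- Over `y` one has `x - z = X - it`. The corrections of the `A j` sum to the correction in `H`
  -- minus the constant `a X^(n+1)/(n+1)`, which survives in the limit.
  have h1 : Tendsto (fun t : ℝ ↦ H (y + t * Complex.I)) atTop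
      (𝓝 (∑ j ∈ Finset.range (n + 1), (n.choose j : ℂ) * X ^ (n - j) * A j
        + a * X ^ (n + 1) / (n + 1))) := by
    refine ((tendsto_finsetSum (Finset.range (n + 1)) fun j hj ↦
      (hA j (Finset.mem_range.mp hj)).const_mul ((n.choose j : ℂ) * X ^ (n - j))).add_const
        _).congr fun t ↦ ?_
    simp only [hH]
    have := sum_choose_mul_pow_succ_div n X (-(t * Complex.I))
    simp only [mul_add, Finset.sum_add_distrib]
    have h2 : ∑ j ∈ Finset.range (n + 1), (n.choose j : ℂ) * X ^ (n - j) *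
        (a * (-(t * Complex.I)) ^ (j + 1) / (j + 1))
        = a * (((X + -(t * Complex.I)) ^ (n + 1) - X ^ (n + 1)) / (n + 1)) := by
      rw [← this, Finset.mul_sum]
      exact Finset.sum_congr rfl fun j _ ↦ by ring
    rw [h2, ← hX]
    ring
  refine (tendsto_vertical_scale one_pos (hf.tendsto_vertical_sub hN hH' y x)
    (by simpa using h1)).congr fun t ↦ ?_
  simp only [hH]
  rw [sub_add_cancel_left, mul_div_assoc]

/-- The regularized value at `i∞` of a primitive of `f (x - z)^n`, transported by `γ⁻¹`. -/
theorem value_transport_eq_sum (hf : IsFormOfLevel N (n + 2) f) (hN : 0 < N) {γ : SL(2, ℤ)}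
    (hγ : f ∣[((n + 2 : ℕ) : ℤ)] γ = f) (hc : γ 1 0 ≠ 0) {x y ξ : ℝ} {σ : ℂ} (hσ0 : σ ≠ 0)
    (hσ : γ 1 0 * x + γ 1 1 = σ) (hξ : ξ * σ = γ 0 0 * x + γ 0 1)
    (hy : y = -(γ 1 1 : ℝ) / γ 1 0) {G : ℕ → ℂ → ℂ}
    (hG : ∀ j z, 0 < z.im → HasDerivAt (G j) (f (ofComplex z) * (y - z) ^ j) z) {B : ℕ → ℂ}
    (hB : ∀ j < n + 1, Tendsto (fun t : ℝ ↦ G j (y + t * Complex.I)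
      - valueAtInfty f / (-γ 1 0 : ℂ) ^ (n + 2) / ((n + 1 - j : ℕ) * (-(t * Complex.I)) ^ (n + 1 - j)))
      (𝓝[>] 0) (𝓝 (B j))) :
    Tendsto (fun t : ℝ ↦ (∑ j ∈ Finset.range (n + 1), (n.choose j : ℂ) * (σ / γ 1 0) ^ (n - j) *
        G j (moebius γ⁻¹ (ξ + t * Complex.I)))
        + σ ^ n * (valueAtInfty f * (-(t * Complex.I)) ^ (n + 1) / (n + 1))) atTop
      (𝓝 (∑ j ∈ Finset.range (n + 1), (n.choose j : ℂ) * (σ / γ 1 0) ^ (n - j) * B j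
        + valueAtInfty f / ((n + 1) * σ * (-γ 1 0 : ℂ) ^ (n + 1)))) := by
  have hc' : (γ 1 0 : ℂ) ≠ 0 := by exact_mod_cast hc
  have hn : (n : ℂ) + 1 ≠ 0 := by exact_mod_cast n.succ_ne_zero
  obtain ⟨i0, i1, i2, i3⟩ := coe_inv_apply γ
  have hc'' : (γ⁻¹) 1 0 ≠ 0 := by rw [i2]; exact neg_ne_zero.mpr hc
  have hyc : (y : ℂ) = -(γ 1 1 : ℂ) / γ 1 0 := by rw [hy]; push_cast; rfl
  have hX : (y : ℂ) + σ / γ 1 0 = x := by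
    rw [hyc, ← hσ]
    field_simp
    ring
  have hX0 : σ / γ 1 0 ≠ 0 := div_ne_zero hσ0 hc'
  set a := valueAtInfty f with ha
  set X : ℂ := σ / γ 1 0 with hXdef
  set P : ℂ → ℂ := fun z ↦ ∑ j ∈ Finset.range (n + 1), (n.choose j : ℂ) * X ^ (n - j) * G j z
    with hP
  have hPderiv : ∀ z : ℂ, 0 < z.im → HasDerivAt P (f (ofComplex z) * (x - z) ^ n) z := by
    intro z hz
    have := hasDerivAt_sum_choose (n := n) (X := X) (F := fun z ↦ f (ofComplex z))
      fun j ↦ hG j z hz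
    rwa [hX] at this
  have hξ' : (ξ : ℂ) * (γ 1 0 * x + γ 1 1) = γ 0 0 * x + γ 0 1 := by rw [hσ, hξ]
  set H : ℂ → ℂ := fun u ↦ P (moebius γ⁻¹ u) + a * σ ^ n * ((ξ - u) ^ (n + 1) / (n + 1)) with hH
  have hH' : ∀ z : ℂ, 0 < z.im →
      HasDerivAt H (σ ^ n * (f (ofComplex z) - a) * (ξ - z) ^ n) z := by
    intro z hz
    convert! (hasDerivAt_comp_moebius_inv hγ hξ' hPderiv hz).add
      ((hasDerivAt_sub_pow_div n ξ z).const_mul (a * σ ^ n)) using 1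
    rw [hσ]
    ring
  have hc2 : (0 : ℝ) < ((γ⁻¹) 1 0 : ℝ) ^ 2 := by positivity
  -- The added constant cancels the `-v^(n+1)` part of `sum_choose_mul_inv_pow`; the part with `(X +
  -- v)^(n+1)` is the correction in `H`.
  have hB' : Tendsto (fun t : ℝ ↦ (∑ j ∈ Finset.range (n + 1), (n.choose j : ℂ) * X ^ (n - j) *
      (G j (y + t * Complex.I) - a / (-γ 1 0 : ℂ) ^ (n + 2) /
        ((n + 1 - j : ℕ) * (-(t * Complex.I)) ^ (n + 1 - j))))
      + a / ((n + 1) * σ * (-γ 1 0 : ℂ) ^ (n + 1))) (𝓝[>] 0)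
      (𝓝 (∑ j ∈ Finset.range (n + 1), (n.choose j : ℂ) * X ^ (n - j) * B j
        + a / ((n + 1) * σ * (-γ 1 0 : ℂ) ^ (n + 1)))) :=
    (tendsto_finsetSum (Finset.range (n + 1)) fun j hj ↦
      (hB j (Finset.mem_range.mp hj)).const_mul ((n.choose j : ℂ) * X ^ (n - j))).add_const _
  have hyγ : y = ((γ⁻¹) 0 0 : ℝ) / (γ⁻¹) 1 0 := by
    rw [hy, i0, i2]
    push_cast
    rw [neg_div, div_neg]
  have h1 := tendsto_moebius_vertical (Φ := fun t z ↦
    (∑ j ∈ Finset.range (n + 1), (n.choose j : ℂ) * X ^ (n - j) *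
      (G j z - a / (-γ 1 0 : ℂ) ^ (n + 2) /
        ((n + 1 - j : ℕ) * (-(t * Complex.I)) ^ (n + 1 - j))))
      + a / ((n + 1) * σ * (-γ 1 0 : ℂ) ^ (n + 1))) γ⁻¹ hc'' hyγ hB'
  have h2 : Tendsto (fun t : ℝ ↦ H ((-((γ⁻¹) 1 1 : ℝ) / (γ⁻¹) 1 0 : ℝ)
      + (t / ((γ⁻¹) 1 0 : ℝ) ^ 2 : ℝ) * Complex.I)) atTop
      (𝓝 (∑ j ∈ Finset.range (n + 1), (n.choose j : ℂ) * X ^ (n - j) * B j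
        + a / ((n + 1) * σ * (-γ 1 0 : ℂ) ^ (n + 1)))) := by
    refine h1.congr' ?_
    filter_upwards [eventually_gt_atTop 0] with t ht
    have ht' : (t : ℂ) ≠ 0 := by exact_mod_cast ht.ne'
    have him : 0 < (((-((γ⁻¹) 1 1 : ℝ) / (γ⁻¹) 1 0 : ℝ) : ℂ)
      + (t / ((γ⁻¹) 1 0 : ℝ) ^ 2 : ℝ) * Complex.I).im := by
      rw [im_vertical]
      positivity
    have hden := denom_vertical γ⁻¹ hc'' t
    have hmoeb := moebius_vertical γ⁻¹ hc'' ht.ne'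
    rw [← hyγ] at hmoeb
    generalize (((-((γ⁻¹) 1 1 : ℝ) / (γ⁻¹) 1 0 : ℝ) : ℂ)
      + (t / ((γ⁻¹) 1 0 : ℝ) ^ 2 : ℝ) * Complex.I) = u at him hden hmoeb ⊢
    simp only [hH, hP]
    have hv0 : -(((t⁻¹ : ℝ) : ℂ) * Complex.I) ≠ 0 := by simp [ht.ne']
    have hxu := sub_moebius_inv γ hξ' him
    rw [hmoeb, hσ, ← hX] at hxu
    rw [i2, i3] at hden
    have hden' : (γ 0 0 : ℂ) - γ 1 0 * u = (-γ 1 0 * -(((t⁻¹ : ℝ) : ℂ) * Complex.I))⁻¹ := by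
      push_cast at hden ⊢
      apply eq_inv_of_mul_eq_one_left
      have h3 : (γ 0 0 : ℂ) - γ 1 0 * u = t * Complex.I / -γ 1 0 := by
        rw [← hden]
        ring
      rw [h3]
      field_simp
      linear_combination -Complex.I_sq
    have hone : ((1 / t : ℝ) : ℂ) = ((t⁻¹ : ℝ) : ℂ) := by rw [one_div]
    rw [hden', hone] at hxu
    have hbin := sum_choose_mul_inv_pow n hX0 hv0
    -- Here `γ⁻¹u = y + i/t`, so `x - γ⁻¹u = X + v` with `v = -i/t`; this expresses the variable at
    -- `i∞` in terms of the one at `-d/c`.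
    have hξu : (ξ : ℂ) - u = (X + -(((t⁻¹ : ℝ) : ℂ) * Complex.I)) /
        (σ * (-γ 1 0 * -(((t⁻¹ : ℝ) : ℂ) * Complex.I))) := by
      rw [div_inv_eq_mul] at hxu
      rw [eq_div_iff (mul_ne_zero hσ0 (mul_ne_zero (neg_ne_zero.mpr hc') hv0))]
      linear_combination -hxu
    rw [hmoeb, hone, hξu]
    generalize -(((t⁻¹ : ℝ) : ℂ) * Complex.I) = v at hv0 hbin ⊢
    have h4 : ∑ j ∈ Finset.range (n + 1), (n.choose j : ℂ) * X ^ (n - j) *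
        (a / (-γ 1 0 : ℂ) ^ (n + 2) / ((n + 1 - j : ℕ) * v ^ (n + 1 - j)))
        = a / (-γ 1 0 : ℂ) ^ (n + 2) *
          (((X + v) ^ (n + 1) - v ^ (n + 1)) / ((n + 1) * X * v ^ (n + 1))) := by
      rw [← hbin, Finset.mul_sum]
      exact Finset.sum_congr rfl fun j _ ↦ by ring
    simp only [mul_sub, Finset.sum_sub_distrib]
    rw [h4, div_pow, mul_pow, mul_pow]
    generalize (X + v) ^ (n + 1) = Q
    rw [hXdef]
    have hc3 : (-γ 1 0 : ℂ) ≠ 0 := neg_ne_zero.mpr hc'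
    rw [show (γ 1 0 : ℂ) = -(-γ 1 0) by ring]
    generalize (-γ 1 0 : ℂ) = c at hc3
    generalize ∑ j ∈ Finset.range (n + 1), (n.choose j : ℂ) * (σ / -c) ^ (n - j) * _ = S
    field_simp
    ring
  have h3 := tendsto_vertical_scale hc2 (hf.tendsto_vertical_sub hN hH' _ ξ) h2
  refine h3.congr fun t ↦ ?_
  simp only [hH, hP]
  rw [sub_add_cancel_left]
  ring

end IsFormOfLevel

end Period

/-! ### Assembly of the reciprocity law. -/

section Main

variable {N n : ℕ} {f : ℍ → ℂ}

theorem dedekindSum_eq (N n : ℕ) (f : ℍ → ℂ) (y : ℚ) :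
    dedekindSum N (n + 2) f y = completedTwistedL N (n + 2) f y ((n : ℂ) + 1) := by
  rw [dedekindSum]
  congr 1
  push_cast
  ring

theorem regularizedPeriod_eq (N n : ℕ) (f : ℍ → ℂ) {γ : SL(2, ℤ)} (hc : γ 1 0 ≠ 0) (X : ℂ) :
    regularizedPeriod N (n + 2) f γ X =
      -∑ j ∈ Finset.range (n + 1), (n.choose j : ℂ) *
        completedTwistedL N (n + 2) f (-(γ 1 1 : ℚ) / γ 1 0) ((j : ℂ) + 1) *
          ((γ 1 0 * X + γ 1 1) / γ 1 0) ^ (n - j)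
      - fourierCoeff N f 0 / ((n : ℂ) + 1) * (((γ 1 0 * X + γ 1 1) / γ 1 0) ^ (n + 1)
          - 1 / ((-(γ 1 0 : ℂ)) ^ (n + 1) * (γ 1 0 * X + γ 1 1))) := by
  have h : ((n + 2 : ℕ) : ℂ) - 1 = n + 1 := by
    push_cast
    ring
  rw [regularizedPeriod]
  simp only [if_neg hc, h, Nat.add_sub_cancel, show n + 2 - 1 = n + 1 from rfl]

theorem exists_regularizedPeriod_eq_eval_div (N n : ℕ) (f : ℍ → ℂ) (γ : SL(2, ℤ)) :
    ∃ P : Polynomial ℂ, ∀ z : ℂ, (γ 1 0 : ℂ) * z + γ 1 1 ≠ 0 →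
      regularizedPeriod N (n + 2) f γ z = P.eval z / (γ 1 0 * z + γ 1 1) := by
  by_cases hc : γ 1 0 = 0
  · exact ⟨0, fun z _ ↦ by simp [regularizedPeriod, hc]⟩
  · open Polynomial in
    let L : ℂ[X] := C (γ 1 0 : ℂ) * X + C (γ 1 1 : ℂ)
    let V : ℂ[X] := C (γ 1 0 : ℂ)⁻¹ * L
    open Polynomial in
    refine ⟨-(∑ j ∈ Finset.range (n + 1), C ((n.choose j : ℂ) *
        completedTwistedL N (n + 2) f (-(γ 1 1 : ℚ) / γ 1 0) ((j : ℂ) + 1)) * V ^ (n - j)) * L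
      - C (fourierCoeff N f 0 / ((n : ℂ) + 1)) * (V ^ (n + 1) * L
          - C (1 / (-(γ 1 0 : ℂ)) ^ (n + 1))), fun z hz ↦ ?_⟩
    have hL : L.eval z = γ 1 0 * z + γ 1 1 := by simp [L]
    have hV : V.eval z = (γ 1 0 * z + γ 1 1) / γ 1 0 := by
      simp [V, hL, div_eq_inv_mul]
    rw [regularizedPeriod_eq N n f hc, eq_div_iff hz]
    simp only [Polynomial.eval_sub, Polynomial.eval_mul, Polynomial.eval_neg, Polynomial.eval_pow,
      Polynomial.eval_finsetSum, Polynomial.eval_C, hL, hV]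
    rw [one_div, one_div, mul_inv]
    field_simp

namespace IsFormOfLevel

/-- Both Dedekind sums come from the same `G`, read directly at `x` and through `γ⁻¹` at `ξ`. Their
values at the cusps cancel up to the `a_0^{(x)}` term, leaving only the values at `i∞`. Nothing is
assumed on `γ 1 0`, so both cases below start here. -/
theorem exists_sub_dedekindSum_eq (hf : IsFormOfLevel N (n + 2) f) (hN : 0 < N) {γ : SL(2, ℤ)}
    (hγ : f ∣[((n + 2 : ℕ) : ℤ)] γ = f) {x ξ : ℚ} {σ : ℂ} (hσ0 : σ ≠ 0)
    (hσ : γ 1 0 * (x : ℂ) + γ 1 1 = σ) (hξ : (ξ : ℂ) * σ = γ 0 0 * x + γ 0 1) {G : ℂ → ℂ}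
    (hG : ∀ z : ℂ, 0 < z.im → HasDerivAt G (f (ofComplex z) * (x - z) ^ n) z) :
    ∃ A A' : ℂ, Tendsto (fun t : ℝ ↦ G ((x : ℝ) + t * Complex.I)
        + valueAtInfty f * (-(t * Complex.I)) ^ (n + 1) / (n + 1)) atTop (𝓝 A) ∧
      Tendsto (fun t : ℝ ↦ G (moebius γ⁻¹ ((ξ : ℝ) + t * Complex.I))
        + σ ^ n * (valueAtInfty f * (-(t * Complex.I)) ^ (n + 1) / (n + 1))) atTop (𝓝 A') ∧
      σ ^ n * dedekindSum N (n + 2) f ξ - dedekindSum N (n + 2) f x =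
        A' - A - cuspConstant (n + 2) f x / (x.den : ℂ) ^ (n + 2) * (γ 1 0 / σ) := by
  obtain ⟨δ, h0, h1⟩ := exists_SL_of_rat x
  have hden : ((δ 1 0 : ℤ) : ℂ) = x.den := by rw [h1]; push_cast; rfl
  have hden0 : (x.den : ℂ) ≠ 0 := by exact_mod_cast x.den_ne_zero
  have hδ : δ 1 0 ≠ 0 := by
    rw [h1]
    exact_mod_cast x.den_ne_zero
  have hxc : (x : ℂ) * δ 1 0 = δ 0 0 := by
    rw [hden, h0]
    exact_mod_cast Rat.mul_den_eq_num x
  have e0 : ((γ * δ) 0 0 : ℂ) = γ 0 0 * δ 0 0 + γ 0 1 * δ 1 0 := by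
    rw [Matrix.SpecialLinearGroup.coe_mul, Matrix.mul_apply, Fin.sum_univ_two]
    push_cast
    rfl
  have e1 : ((γ * δ) 1 0 : ℂ) = δ 1 0 * σ := by
    rw [Matrix.SpecialLinearGroup.coe_mul, Matrix.mul_apply, Fin.sum_univ_two, ← hσ]
    push_cast
    linear_combination (-γ 1 0 : ℂ) * hxc
  have hp : (δ 1 0 : ℂ) ≠ 0 := by rwa [hden]
  have hγδc : ((γ * δ) 1 0 : ℂ) ≠ 0 := by
    rw [e1]
    exact mul_ne_zero hp hσ0
  have hγδ : (γ * δ) 1 0 ≠ 0 := by exact_mod_cast hγδc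
  have hx : (x : ℝ) = (δ 0 0 : ℝ) / δ 1 0 := by
    have : ((x : ℝ) : ℂ) = (((δ 0 0 : ℝ) / δ 1 0 : ℝ) : ℂ) := by
      push_cast
      rw [eq_div_iff hp, hxc]
    exact_mod_cast this
  have hξ' : (ξ : ℝ) = ((γ * δ) 0 0 : ℝ) / (γ * δ) 1 0 := by
    have : ((ξ : ℝ) : ℂ) = ((((γ * δ) 0 0 : ℝ) / (γ * δ) 1 0 : ℝ) : ℂ) := by
      push_cast
      rw [eq_div_iff hγδc, e1, e0]
      linear_combination (δ 1 0 : ℂ) * hξ + (γ 0 0 : ℂ) * hxc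
    exact_mod_cast this
  have hslash : f ∣[((n + 2 : ℕ) : ℤ)] (γ * δ) = f ∣[((n + 2 : ℕ) : ℤ)] δ := by
    rw [SlashAction.slash_mul, hγ]
  have hG' : ∀ z : ℂ, 0 < z.im → HasDerivAt (fun z ↦ (σ ^ n)⁻¹ * G (moebius γ⁻¹ z))
      (f (ofComplex z) * (ξ - z) ^ n) z := by
    intro z hz
    convert! (hasDerivAt_comp_moebius_inv hγ (by rw [hσ, hξ]) hG hz).const_mul (σ ^ n)⁻¹ using 1
    rw [hσ, inv_mul_cancel_left₀ (pow_ne_zero n hσ0)]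
  obtain ⟨A, B, hA, hB, hAB⟩ :=
    hf.exists_tendsto_completedTwistedL hN (j := n) (l := 1) rfl one_pos hδ hx hG
  obtain ⟨A', B', hA', hB', hAB'⟩ :=
    hf.exists_tendsto_completedTwistedL hN (j := n) (l := 1) rfl one_pos hγδ hξ' hG'
  rw [hslash] at hB'
  refine ⟨A, σ ^ n * A', hA, (hA'.const_mul (σ ^ n)).congr fun t ↦ ?_, ?_⟩
  · rw [mul_add, mul_inv_cancel_left₀ (pow_ne_zero n hσ0)]
  · have hBB := hf.cusp_value_transport hN hδ hγδ hx hξ' (σ := σ)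
      (fun z hz ↦ by simpa using hG z hz) (by simpa using hσ.symm) hB hB'
    rw [dedekindSum_eq, dedekindSum_eq, hAB, hAB', hf.cuspConstant_eq hN h0 h1, ← hden]
    linear_combination -hBB

/-- Reciprocity for an element fixing the cusp `i∞`. -/
theorem sub_dedekindSum_of_eq_zero (hf : IsFormOfLevel N (n + 2) f) (hN : 0 < N) {γ : SL(2, ℤ)}
    (hγ : f ∣[((n + 2 : ℕ) : ℤ)] γ = f) (hc : γ 1 0 = 0) {x ξ : ℚ} {σ : ℂ} (hσ0 : σ ≠ 0)
    (hσ : γ 1 0 * (x : ℂ) + γ 1 1 = σ) (hξ : (ξ : ℂ) * σ = γ 0 0 * x + γ 0 1) :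
    σ ^ n * dedekindSum N (n + 2) f ξ = dedekindSum N (n + 2) f x := by
  have hdiff : DifferentiableOn ℂ (fun z ↦ f (ofComplex z) * (x - z) ^ n) {z : ℂ | 0 < z.im} :=
    hf.differentiableOn.mul (by fun_prop)
  obtain ⟨G, hG⟩ := exists_primitive hdiff
  obtain ⟨A, A', hA, hA', h⟩ := hf.exists_sub_dedekindSum_eq hN hγ hσ0 hσ hξ hG
  have hσd : σ = γ 1 1 := by rw [← hσ, hc]; simp
  have hdet : (γ 0 0 : ℂ) * σ = 1 := by
    have := det_complex γ
    rw [hc] at this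
    rw [hσd, ← this]
    simp
  have hunit : (γ 0 0 : ℂ) = σ := by
    have : γ 0 0 * γ 1 1 = 1 := by
      rw [hσd] at hdet
      exact_mod_cast hdet
    rw [hσd]
    exact_mod_cast Int.eq_of_mul_eq_one this
  have hσ2 : σ ^ 2 = 1 := by rw [sq, ← hdet, hunit]
  have hmoeb : ∀ u : ℂ, moebius γ u = u + (ξ - x) := fun u ↦ by
    rw [moebius, hc, Int.cast_zero, zero_mul, zero_add, ← hσd, div_eq_iff hσ0]
    rw [hunit] at hξ ⊢
    linear_combination -hξ
  have hinv : ∀ t : ℝ, 0 < t → moebius γ⁻¹ ((ξ : ℝ) + t * Complex.I) = (x : ℝ) + t * Complex.I := by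
    intro t ht
    have h1 : moebius γ ((x : ℝ) + t * Complex.I) = (ξ : ℝ) + t * Complex.I := by
      rw [hmoeb]
      push_cast
      ring
    rw [← h1, ← moebius_mul γ⁻¹ γ (by rwa [im_vertical]), inv_mul_cancel]
    simp [moebius]
  -- Here `γ` is a translation up to sign and `σ = ±1`. If `σ^n = -1`, this forces the constant term
  -- to vanish, as needed to match the corrections in `A` and `A'`.
  have hval : valueAtInfty f = σ ^ n * valueAtInfty f := by
    have hlim := hf.tendsto_valueAtInfty hN
    have h1 := hlim.comp (tendsto_ofComplex_vertical (ξ : ℝ) one_pos)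
    have h2 := (hlim.comp (tendsto_ofComplex_vertical (x : ℝ) one_pos)).const_mul (σ ^ n)
    refine tendsto_nhds_unique_of_eventuallyEq h1 h2 ?_
    filter_upwards [eventually_gt_atTop 0] with t ht
    have him : 0 < (((x : ℝ) : ℂ) + ((t : ℝ) : ℂ) * Complex.I).im := by rwa [im_vertical]
    have := comp_ofComplex_moebius (n + 2) f γ him
    rw [hγ, hc, Int.cast_zero, zero_mul, zero_add, ← hσd, pow_add, hσ2, mul_one, hmoeb] at this
    simp only [Function.comp_apply]
    convert this using 3 <;> push_cast <;> ring_nf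
  have hAA : A' = A := by
    refine tendsto_nhds_unique_of_eventuallyEq hA' hA ?_
    filter_upwards [eventually_gt_atTop 0] with t ht
    rw [hinv t ht]
    linear_combination (-(-(t * Complex.I)) ^ (n + 1) / (n + 1)) * hval
  rw [hAA, hc, Int.cast_zero] at h
  linear_combination h

/-- The primitive of `f(z) (x - z)^n` is chosen as the binomial combination of primitives centred at
`y = γ⁻¹∞`. Then `A'` is expressed by the values `B j` at `y` and `A` by the values `A j` at `i∞`,
and their differences are the critical values at `y`. -/
theorem sub_dedekindSum_of_ne_zero (hf : IsFormOfLevel N (n + 2) f) (hN : 0 < N) {γ : SL(2, ℤ)}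
    (hγ : f ∣[((n + 2 : ℕ) : ℤ)] γ = f) (hc : γ 1 0 ≠ 0) {x ξ : ℚ} {σ : ℂ} (hσ0 : σ ≠ 0)
    (hσ : γ 1 0 * (x : ℂ) + γ 1 1 = σ) (hξ : (ξ : ℂ) * σ = γ 0 0 * x + γ 0 1) :
    σ ^ n * dedekindSum N (n + 2) f ξ - dedekindSum N (n + 2) f x =
      regularizedPeriod N (n + 2) f γ x
        - cuspConstant (n + 2) f x / (x.den : ℂ) ^ (n + 2) * (γ 1 0 / σ) := by
  have hc' : (γ 1 0 : ℂ) ≠ 0 := by exact_mod_cast hc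
  set y : ℚ := -(γ 1 1 : ℚ) / γ 1 0 with hy
  have hyr : (y : ℝ) = -(γ 1 1 : ℝ) / γ 1 0 := by rw [hy]; push_cast; rfl
  have hyc : ((y : ℝ) : ℂ) = -(γ 1 1 : ℂ) / γ 1 0 := by rw [hyr]; push_cast; rfl
  have hX : ((y : ℝ) : ℂ) + σ / γ 1 0 = (x : ℝ) := by
    rw [hyc, ← hσ]
    push_cast
    field_simp
    ring
  have hdiff : ∀ j : ℕ,
      DifferentiableOn ℂ (fun z ↦ f (ofComplex z) * ((y : ℝ) - z) ^ j) {z : ℂ | 0 < z.im} := fun j ↦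
    hf.differentiableOn.mul (by fun_prop)
  choose G hG using fun j ↦ exists_primitive (hdiff j)
  obtain ⟨i0, i1, i2, i3⟩ := coe_inv_apply γ
  have hc'' : (γ⁻¹) 1 0 ≠ 0 := by rw [i2]; exact neg_ne_zero.mpr hc
  have hyγ : (y : ℝ) = ((γ⁻¹) 0 0 : ℝ) / (γ⁻¹) 1 0 := by
    rw [hyr, i0, i2]
    push_cast
    rw [neg_div, div_neg]
  have hγ' : f ∣[((n + 2 : ℕ) : ℤ)] γ⁻¹ = f := by
    nth_rewrite 1 [← hγ]
    rw [← SlashAction.slash_mul, mul_inv_cancel, SlashAction.slash_one]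
  have hvals : ∀ j, ∃ A B, j < n + 1 →
      Tendsto (fun t : ℝ ↦ G j ((y : ℝ) + t * Complex.I)
        + valueAtInfty f * (-(t * Complex.I)) ^ (j + 1) / (j + 1)) atTop (𝓝 A) ∧
      Tendsto (fun t : ℝ ↦ G j ((y : ℝ) + t * Complex.I)
        - valueAtInfty f / (-γ 1 0 : ℂ) ^ (n + 2) /
          ((n + 1 - j : ℕ) * (-(t * Complex.I)) ^ (n + 1 - j))) (𝓝[>] 0) (𝓝 B) ∧
      completedTwistedL N (n + 2) f y ((j : ℂ) + 1) = A - B := by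
    intro j
    by_cases hj : j < n + 1
    · obtain ⟨A, B, h⟩ := hf.exists_tendsto_completedTwistedL hN (j := j) (l := n + 1 - j)
        (by omega) (by omega) hc'' hyγ (fun z hz ↦ by simpa using hG j z hz)
      -- Since `f ∣ γ⁻¹ = f`, the constant term at the cusp `y` is that at `i∞`; this is why `a_0`
      -- alone occurs in `R_{f,γ}`.
      rw [hγ', i2, Int.cast_neg] at h
      exact ⟨A, B, fun _ ↦ h⟩
    · exact ⟨0, 0, fun h ↦ absurd h hj⟩
  choose A B hAB using hvals
  have hP : ∀ z : ℂ, 0 < z.im → HasDerivAt (fun z ↦ ∑ j ∈ Finset.range (n + 1),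
      (n.choose j : ℂ) * (σ / γ 1 0) ^ (n - j) * G j z) (f (ofComplex z) * (x - z) ^ n) z := by
    intro z hz
    have := hasDerivAt_sum_choose (n := n) (X := σ / γ 1 0) (F := fun z ↦ f (ofComplex z))
      fun j ↦ hG j z hz
    rwa [hX, Complex.ofReal_ratCast] at this
  obtain ⟨a, a', ha, ha', h⟩ := hf.exists_sub_dedekindSum_eq hN hγ hσ0 hσ hξ hP
  have h1 := tendsto_nhds_unique ha (hf.value_atInfty_eq_sum hN hX hG fun j hj ↦ (hAB j hj).1)
  have h2 := tendsto_nhds_unique ha' (hf.value_transport_eq_sum hN hγ hc hσ0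
    (x := (x : ℝ)) (ξ := (ξ : ℝ)) (by rwa [Complex.ofReal_ratCast])
    (by rwa [Complex.ofReal_ratCast, Complex.ofReal_ratCast]) hyr hG fun j hj ↦ (hAB j hj).2.1)
  have h3 : ∑ j ∈ Finset.range (n + 1), (n.choose j : ℂ) *
      completedTwistedL N (n + 2) f y ((j : ℂ) + 1) * (σ / γ 1 0) ^ (n - j)
      = ∑ j ∈ Finset.range (n + 1), (n.choose j : ℂ) * (σ / γ 1 0) ^ (n - j) * A j
        - ∑ j ∈ Finset.range (n + 1), (n.choose j : ℂ) * (σ / γ 1 0) ^ (n - j) * B j := by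
    rw [← Finset.sum_sub_distrib]
    refine Finset.sum_congr rfl fun j hj ↦ ?_
    rw [(hAB j (Finset.mem_range.mp hj)).2.2]
    ring
  have hn : (n : ℂ) + 1 ≠ 0 := by exact_mod_cast n.succ_ne_zero
  rw [h, h1, h2, regularizedPeriod_eq N n f hc, hσ, ← hy, h3, hf.fourierCoeff_zero hN]
  field_simp
  ring

end IsFormOfLevel

end Main

end DedekindReciprocity

theorem theorem2p2 (Γ : Subgroup SL(2, ℤ)) (N : ℕ) (hN : 0 < N)
    (hΓ : CongruenceSubgroup.Gamma N ≤ Γ) (k : ℕ) (hk : 2 ≤ k)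
    (f : ModularForm (Γ.map (Matrix.SpecialLinearGroup.mapGL ℝ)) (k : ℤ)) :
    -- the completed twisted L-functions exist
    (∀ y : ℚ, DedekindReciprocity.IsCompletedTwistedL N k f y
      (DedekindReciprocity.completedTwistedL N k f y)) ∧
    -- the constant terms at the cusps are well defined
    (∀ x : ℚ, ∃! a : ℂ, DedekindReciprocity.IsCuspConstant k f x a) ∧
    ∀ γ ∈ Γ,
      -- `R_{f,γ} ∈ (cX + d)⁻¹ ℂ[X]`
      (∃ P : Polynomial ℂ, ∀ z : ℂ, (γ 1 0 : ℂ) * z + (γ 1 1 : ℂ) ≠ 0 →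
        DedekindReciprocity.regularizedPeriod N k f γ z =
          P.eval z / ((γ 1 0 : ℂ) * z + (γ 1 1 : ℂ))) ∧
      -- reciprocity
      ∀ x : ℚ, (γ 1 0 : ℚ) * x + (γ 1 1 : ℚ) ≠ 0 →
        ((γ 1 0 : ℂ) * (x : ℂ) + (γ 1 1 : ℂ)) ^ (k - 2) *
            DedekindReciprocity.dedekindSum N k f
              (((γ 0 0 : ℚ) * x + (γ 0 1 : ℚ)) / ((γ 1 0 : ℚ) * x + (γ 1 1 : ℚ)))
          - DedekindReciprocity.dedekindSum N k f x
        = DedekindReciprocity.regularizedPeriod N k f γ (x : ℂ)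
          - DedekindReciprocity.cuspConstant k f x / (x.den : ℂ) ^ k *
            ((γ 1 0 : ℂ) / ((γ 1 0 : ℂ) * (x : ℂ) + (γ 1 1 : ℂ))) := by
  have hf := DedekindReciprocity.isFormOfLevel_of_modularForm hN hΓ f
  refine ⟨hf.isCompletedTwistedL hN hk, hf.existsUnique_isCuspConstant hN, fun γ hγ ↦ ?_⟩
  have hslash : (f : ℍ → ℂ) ∣[(k : ℤ)] γ = f :=
    f.slash_action_eq' _ (Subgroup.mem_map_of_mem _ hγ)
  -- Writing `k = n + 2` removes the truncated subtractions `k - 2` and `k - 1`.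
  obtain ⟨n, rfl⟩ := Nat.exists_eq_add_of_le' hk
  refine ⟨DedekindReciprocity.exists_regularizedPeriod_eq_eval_div N n f γ, fun x hx ↦ ?_⟩
  have hσ0 : (γ 1 0 : ℂ) * (x : ℂ) + γ 1 1 ≠ 0 := by exact_mod_cast hx
  have hξ : (((((γ 0 0 : ℚ) * x + (γ 0 1 : ℚ)) / ((γ 1 0 : ℚ) * x + (γ 1 1 : ℚ)) : ℚ)) : ℂ)
      * ((γ 1 0 : ℂ) * (x : ℂ) + γ 1 1) = γ 0 0 * x + γ 0 1 := by
    push_cast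
    exact div_mul_cancel₀ _ hσ0
  rw [Nat.add_sub_cancel]
  by_cases hc : γ 1 0 = 0
  · rw [hf.sub_dedekindSum_of_eq_zero hN hslash hc hσ0 rfl hξ, sub_self]
    simp [DedekindReciprocity.regularizedPeriod, hc]
  · exact hf.sub_dedekindSum_of_ne_zero hN hslash hc hσ0 rfl hξ
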